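/- **Setting.** Let $V=\{v_0,v_1,v_2,\dots\}$, let $M(V)$ be the free magma on $V$ with product $\star$, $M(V)_{\mathbb Q}$ its $\mathbb Q$-span (the free non-associative algebra), and $(\mathrm{Lie}(V),[\cdot,\cdot])$ the free Lie algebra over $\mathbb Q$, with the canonical surjection $\mathrm{Lie}:M(V)_{\mathbb Q}\to \mathrm{Lie}(V)$, $x\star y\mapsto[x,y]$. For $t\in M(V)$ with letters $v_{k_1},\dots,v_{k_d}$ from left to right write $t=t(\mathbf k)$, and let $t(\mathbf l)$ be obtained by replacing $\mathbf k$ by $\mathbf l\in\mathbb Z_{\ge0}^d$. A post-Lie algebra is a Lie algebra $(\mathfrak g,[\cdot,\cdot])$ with a bilinear map $\triangleright$ such that $x\triangleright[y,z]=[x\triangleright y,z]+[y,x\triangleright z]$ and $[x,y]\triangleright z=x\triangleright(y\triangleright z)-(x\triangleright y)\triangleright z-y\triangleright(x\triangleright z)+(y\triangleright x)\triangleright z$. **Multiplicities.** The ari multiplicities are $m_{\mathbf k,\mathbf l}=(-1)^{|\mathbf k|+|\mathbf l|}\prod_i\binom{k_i-1}{l_i-1}$, where $\binom{k-1}{l-1}$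 is $1$ if $k=l=0$ and $0$ if exactly one of $k,l$ is $0$. Let $\mathcal C(n)$ be the set of compositions $\boldsymbol\alpha=(\alpha_1,\dots,\alpha_s)$ of $n$ into positive parts, $\ell(\boldsymbol\alpha)=s$, $|\boldsymbol\alpha|=n$. The threshold index $\mathrm{ind}_a(\boldsymbol\alpha)$ is the least $1\le j\le s$ with $\alpha_1+\dots+\alpha_j\ge a$, and $0$ if there is none. With the Bernoulli numbers $B_k$ ($B_1=-\tfrac12$) put $B_1(m,n)=\frac1{m!}\sum_{k=0}^{n-1}\binom mk B_k$. The uri multiplicities are $\mu_{a,\boldsymbol\alpha}=B_1(\ell(\boldsymbol\alpha),\mathrm{ind}_a(\boldsymbol\alpha))$, and $\mu_{a,\boldsymbol\alpha}=0$ if $\mathrm{ind}_a(\boldsymbol\alpha)=0$ or $a\le 0$. **Products.** For $t=t(\mathbf k)\in M(V)$ with $d$ letters put $t\triangleright_a v_0=t\triangleright_u v_0=0$ and, for $a\ge1$, $$t\triangleright_a v_a=\sum_{\mathbf l\in\mathbb Z_{\ge0}^d}m_{\mathbf k,\mathbf l}\;v_{a+|\mathbf k-\mathbf l|}\star t(\mathbf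 l),$$ $$t\triangleright_u v_a=\sum_{\mathbf l\in\mathbb Z_{\ge0}^d}m_{\mathbf k,\mathbf l}\sum_{\boldsymbol\alpha\in\mathcal C(a+|\mathbf k-\mathbf l|)}\mu_{a,\boldsymbol\alpha}\;v_{\alpha_1}\star(v_{\alpha_2}\star(\cdots\star(v_{\alpha_{\ell(\boldsymbol\alpha)}}\star t(\mathbf l))\cdots)),$$ where $|\mathbf k-\mathbf l|=\sum_i(k_i-l_i)$ (only $\mathbf l\le\mathbf k$ contribute). Extend both to $M(V)_{\mathbb Q}\otimes M(V)_{\mathbb Q}\to M(V)_{\mathbb Q}$, linearly in the left factor and as derivations for $\star$ in the right factor. **Threshold shuffle identities.** Extend $\mu_{a,\cdot}$ linearly to formal sums of sequences of positive integers; let $\sqcup\!\sqcup$ be the shuffle product, $(\cdot,\cdot)$ (bilinear) concatenation and $\overline{(k_1,\dots,k_d)}=(-1)^d(k_d,\dots,k_1)$. The identities are, for all sequences $\sigma,\tau,\vartheta$ of positive integers with $\tau\neq\emptyset$ and all $d_1,d_2\in\mathbb Z_{\ge0}$ (a product whose first factor $\mu_{c,\cdot}$ has $c\le0$ being $0$):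 (i) with $t=|\sigma|+|\vartheta|-d_1-d_2$, $$\mu_{t,\sigma\mathbin{\sqcup\!\sqcup}\vartheta}=\sum_{\substack{(\sigma_1,\sigma_2)=\sigma\\(\vartheta_1,\vartheta_2)=\vartheta}}\Big(\mu_{|\sigma_2|-d_1,\sigma_2}\,\mu_{t,(\sigma_1\mathbin{\sqcup\!\sqcup}\vartheta_1,\,|\sigma_2|-d_1,\,\vartheta_2)}+\mu_{|\vartheta_2|-d_2,\vartheta_2}\,\mu_{t,(\sigma_1\mathbin{\sqcup\!\sqcup}\vartheta_1,\,|\vartheta_2|-d_2,\,\sigma_2)}\Big);$$ (ii) with $t=|\sigma|+|\tau|+|\vartheta|-d_1-d_2$, $$0=\sum_{\substack{(\sigma_1,\sigma_2)=\sigma\\(\tau_1,\tau_2)=\tau\\(\vartheta_1,\vartheta_2)=\vartheta}}\Big(\mu_{|\sigma_2|+|\tau_1|-d_1,\,\sigma_2\mathbin{\sqcup\!\sqcup}\overline{\tau_1}}\;\mu_{t,(\sigma_1\mathbin{\sqcup\!\sqcup}\overline{\vartheta_2},\,|\sigma_2|+|\tau_1|-d_1,\,\tau_2\mathbin{\sqcup\!\sqcup}\overline{\vartheta_1})}+\mu_{|\tau_2|+|\vartheta_1|-d_2,\,\tau_2\mathbin{\sqcup\!\sqcup}\overline{\vartheta_1}}\;\mu_{t,(\sigma_1\mathbin{\sqcup\!\sqcup}\overline{\vartheta_2},\,|\tau_2|+|\vartheta_1|-d_2,\,\sigma_2\mathbin{\sqcup\!\sqcup}\overline{\tau_1})}\Big).$$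 **Theorem.** The maps $\triangleright_u$ and $\triangleright_a$ descend (uniquely) to bilinear maps $\mathrm{Lie}(V)\otimes\mathrm{Lie}(V)\to\mathrm{Lie}(V)$. If the uri multiplicities satisfy the threshold shuffle identities, then $(\mathrm{Lie}(V),[\cdot,\cdot],\triangleright_u)$ is a post-Lie algebra. Moreover, unconditionally, the associated depth-graded product of $\triangleright_u$ is $\triangleright_a$: if $\mathrm{Lie}(V)_p$ is the span of the iterated brackets of $p$ letters and $F^p=\sum_{e\ge p}\mathrm{Lie}(V)_e$, then $F^p\triangleright_u F^q\subseteq F^{p+q}$, $\mathrm{Lie}(V)_p\triangleright_a\mathrm{Lie}(V)_q\subseteq\mathrm{Lie}(V)_{p+q}$, and $x\triangleright_u y-x\triangleright_a y\in F^{p+q+1}$ for $x\in F^p$, $y\in F^q$. -/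

import Mathlib

namespace UriPostLie

open FreeMagma

/-! ### Post-Lie algebras -/

/-- `(L, ⁅·,·⁆, tri)` is a post-Lie algebra over `k`. -/
structure IsPostLie {k L : Type*} [Field k] [LieRing L] [LieAlgebra k L]
    (tri : L →ₗ[k] L →ₗ[k] L) : Prop where
  /-- `x ▷ ·` is a derivation of the Lie bracket. -/
  derivation : ∀ x y z : L, tri x ⁅y, z⁆ = ⁅tri x y, z⁆ + ⁅y, tri x z⁆
  /-- The action of a Lie bracket. -/
  bracket : ∀ x y z : L,
    tri ⁅x, y⁆ z = tri x (tri y z) - tri (tri x y) z - tri y (tri x z) + tri (tri y x) z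

/-! ### The free magma on `V = {v₀, v₁, …}` and the free Lie algebra `Lie(V)`

The letter `v_i` is represented by its index `i : ℕ`. -/

/-- The rational span of the free magma `M(V)`: the free non-associative algebra on `V`. -/
abbrev MagAlg : Type := FreeNonUnitalNonAssocAlgebra ℚ ℕ

/-- The free Lie algebra `Lie(V)` over `ℚ`. -/
abbrev LieV : Type := FreeLieAlgebra ℚ ℕ

/-- An element of the free magma, as a basis vector of its rational span. -/
noncomputable def elt (t : FreeMagma ℕ) : MagAlg := MonoidAlgebra.single t 1

/-- The canonical surjection from the free non-associative algebra to `Lie(V)`, which sends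
`v_i` to `v_i` and `x ⋆ y` to `⁅x, y⁆`. -/
noncomputable def lieMap : MagAlg →ₗ[ℚ] LieV where
  toFun x := FreeLieAlgebra.mk ℚ x
  map_add' x y := map_add (FreeLieAlgebra.mk ℚ) x y
  map_smul' c x := map_smul (FreeLieAlgebra.mk ℚ) c x

theorem lieMap_letter (i : ℕ) : lieMap (elt (of i)) = FreeLieAlgebra.of ℚ i := rfl

theorem lieMap_mul (x y : MagAlg) : lieMap (x * y) = ⁅lieMap x, lieMap y⁆ := rfl

/-- The sequence `𝐤` of the indices of the letters of `t = t(𝐤)`, from left to right. -/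
def leaves : (t : FreeMagma ℕ) → Fin t.length → ℕ
  | FreeMagma.of a => fun _ => a
  | FreeMagma.mul x y => Fin.append (leaves x) (leaves y)

/-- The element `t(𝐥)` of the free magma: the indices of the letters of `t` are replaced, from left
to right, by the entries of `𝐥`. -/
def relabel : (t : FreeMagma ℕ) → (Fin t.length → ℕ) → FreeMagma ℕ
  | FreeMagma.of _, l => FreeMagma.of (l ⟨0, Nat.one_pos⟩)
  | FreeMagma.mul x y, l =>
      relabel x (fun i => l (Fin.castAdd y.length i)) *
        relabel y (fun i => l (Fin.natAdd x.length i))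

/-- The element `v_{α₁} ⋆ (v_{α₂} ⋆ (⋯ ⋆ (v_{α_s} ⋆ t)⋯))` of the free magma. -/
def nest (α : List ℕ) (t : FreeMagma ℕ) : FreeMagma ℕ :=
  α.foldr (fun i s => FreeMagma.of i * s) t

/-- Given `t ▷ v_a` for all magma elements `t` and all letters `v_a`, the element `t ▷ s` for a
magma element `s`, where `t ▷ ·` is extended as a derivation for `⋆`. -/
noncomputable def triTree (f : FreeMagma ℕ → ℕ → MagAlg) (t : FreeMagma ℕ) :
    FreeMagma ℕ → MagAlg
  | FreeMagma.of a => f t a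
  | FreeMagma.mul u v => triTree f t u * elt v + elt u * triTree f t v

/-- The bilinear product on the free non-associative algebra which extends `(t, v_a) ↦ f t a`
linearly in the left factor and as a derivation in the right factor. -/
noncomputable def triExt (f : FreeMagma ℕ → ℕ → MagAlg) : MagAlg →ₗ[ℚ] MagAlg →ₗ[ℚ] MagAlg :=
  (Finsupp.linearCombination ℚ fun t : FreeMagma ℕ =>
      (Finsupp.linearCombination ℚ (triTree f t)) ∘ₗ
        (MonoidAlgebra.coeffLinearEquiv ℚ).toLinearMap) ∘ₗ
    (MonoidAlgebra.coeffLinearEquiv ℚ).toLinearMap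

/-! ### The multiplicities -/

/-- The binomial coefficient `(k - 1 choose l - 1)` of non-negative integers, with value `1` for
`k = l = 0` and value `0` if exactly one of `k, l` is zero. -/
def predChoose : ℕ → ℕ → ℕ
  | 0, 0 => 1
  | k + 1, l + 1 => k.choose l
  | _, _ => 0

/-- The ari multiplicity `m_{𝐤,𝐥}`. -/
def ariMult {d : ℕ} (k l : Fin d → ℕ) : ℚ :=
  (-1) ^ (∑ i, k i + ∑ i, l i) * ∏ i, (predChoose (k i) (l i) : ℚ)

open Classical in
/-- The threshold index of `α`: the least `1 ≤ j ≤ ℓ(α)` with `α₁ + ⋯ + α_j ≥ a`, and `0` if there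
is none. -/
noncomputable def thresholdIndex (a : ℕ) (α : List ℕ) : ℕ :=
  if h : ∃ j, 1 ≤ j ∧ j ≤ α.length ∧ a ≤ (α.take j).sum then Nat.find h else 0

/-- The multiplicity `μ^B_{a,α} = B(ℓ(α), thresholdIndex a α)` attached to `B`, which is `0` if
the threshold index is `0` or if `a` is not positive. -/
noncomputable def thresholdMult (B : ℕ → ℕ → ℚ) (a : ℕ) (α : List ℕ) : ℚ :=
  if a = 0 ∨ thresholdIndex a α = 0 then 0 else B α.length (thresholdIndex a α)

/-- `B₁(m,n) = (1 / m!) ∑_{k < n} (m choose k) B_k`, with the Bernoulli numbers `B_k`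
(`B_1 = -1/2`). -/
def B₁ (m n : ℕ) : ℚ :=
  (1 / (m.factorial : ℚ)) * ∑ k ∈ Finset.range n, (m.choose k : ℚ) * bernoulli k

/-- The uri multiplicities `μ_{a,α}`. -/
noncomputable def uriMult : ℕ → List ℕ → ℚ := thresholdMult B₁

/-! ### The products `▷_a` and `▷_u` on the free non-associative algebra

The sums over `𝐥` run over `𝐥 ≤ 𝐤`, since `m_{𝐤,𝐥} = 0` otherwise. -/

/-- `t(𝐤) ▷_a v_s`. -/
noncomputable def ariLetter (t : FreeMagma ℕ) (s : ℕ) : MagAlg :=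
  if s = 0 then 0
  else ∑ l ∈ Finset.Iic (leaves t),
    ariMult (leaves t) l •
      elt (FreeMagma.of (s + ∑ i, (leaves t i - l i)) * relabel t l)

/-- `t(𝐤) ▷_u v_a`. -/
noncomputable def uriLetter (t : FreeMagma ℕ) (a : ℕ) : MagAlg :=
  if a = 0 then 0
  else ∑ l ∈ Finset.Iic (leaves t),
    ariMult (leaves t) l •
      ∑ α : Composition (a + ∑ i, (leaves t i - l i)),
        uriMult a α.blocks • elt (nest α.blocks (relabel t l))

/-- The product `▷_a` on the free non-associative algebra. -/
noncomputable def ariMag : MagAlg →ₗ[ℚ] MagAlg →ₗ[ℚ] MagAlg := triExt ariLetter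

/-- The product `▷_u` on the free non-associative algebra. -/
noncomputable def uriMag : MagAlg →ₗ[ℚ] MagAlg →ₗ[ℚ] MagAlg := triExt uriLetter

/-- The product `tri` on the free non-associative algebra descends to the product `T` on
`Lie(V)`. -/
def DescendsTo (tri : MagAlg →ₗ[ℚ] MagAlg →ₗ[ℚ] MagAlg) (T : LieV →ₗ[ℚ] LieV →ₗ[ℚ] LieV) : Prop :=
  ∀ x y : MagAlg, lieMap (tri x y) = T (lieMap x) (lieMap y)

/-! ### The threshold shuffle identities -/

/-- The list (with multiplicities) of all shuffles of two sequences. -/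
def shuffle : List ℕ → List ℕ → List (List ℕ)
  | [], bs => [bs]
  | a :: as, [] => [a :: as]
  | a :: as, b :: bs =>
      (shuffle as (b :: bs)).map (fun w => a :: w) ++ (shuffle (a :: as) bs).map (fun w => b :: w)
  termination_by as bs => as.length + bs.length

/-- The list (with multiplicities) of the sequences `(u, c, v)` with `u` from `L` and `v`
from `R`. -/
def glue (L : List (List ℕ)) (c : ℕ) (R : List (List ℕ)) : List (List ℕ) :=
  L.flatMap fun u => R.map fun v => u ++ c :: v

/-- The linear extension of `μ_{t, ·}` to a formal sum of sequences. -/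
def sumMult (μ : ℕ → List ℕ → ℚ) (t : ℕ) (L : List (List ℕ)) : ℚ := (L.map (μ t)).sum

/-- The threshold shuffle identities for a multiplicity `μ`, where `μ 0 _ = 0`.

The decompositions `(σ₁, σ₂) = σ` are `σ₁ = σ.take i`, `σ₂ = σ.drop i` for `0 ≤ i ≤ ℓ(σ)`. The
differences `|σ₂| - d₁`, … are truncated at `0`: a first index of a multiplicity that is not a
positive integer makes the multiplicity zero. The reversal of a sequence `τ` carries the sign
`(-1) ^ ℓ(τ)`. -/
structure ThresholdShuffle (μ : ℕ → List ℕ → ℚ) : Prop where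
  /-- The identities for `σ, ϑ`. -/
  two : ∀ σ θ : List ℕ, (∀ x ∈ σ, 0 < x) → (∀ x ∈ θ, 0 < x) → ∀ d₁ d₂ t : ℕ,
    t = σ.sum + θ.sum - d₁ - d₂ →
    sumMult μ t (shuffle σ θ) =
      ∑ i ∈ Finset.range (σ.length + 1), ∑ j ∈ Finset.range (θ.length + 1),
        (μ ((σ.drop i).sum - d₁) (σ.drop i) *
            sumMult μ t
              (glue (shuffle (σ.take i) (θ.take j)) ((σ.drop i).sum - d₁) [θ.drop j]) +
          μ ((θ.drop j).sum - d₂) (θ.drop j) *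
            sumMult μ t
              (glue (shuffle (σ.take i) (θ.take j)) ((θ.drop j).sum - d₂) [σ.drop i]))
  /-- The identities for `σ, τ, ϑ`, where `τ` is not the empty sequence. -/
  three : ∀ σ τ θ : List ℕ, (∀ x ∈ σ, 0 < x) → (∀ x ∈ τ, 0 < x) → (∀ x ∈ θ, 0 < x) → τ ≠ [] →
    ∀ d₁ d₂ t : ℕ, t = σ.sum + τ.sum + θ.sum - d₁ - d₂ →
    0 = ∑ i ∈ Finset.range (σ.length + 1), ∑ p ∈ Finset.range (τ.length + 1),
        ∑ j ∈ Finset.range (θ.length + 1),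
          (-1) ^ ((τ.take p).length + (θ.take j).length + (θ.drop j).length) *
          (sumMult μ ((σ.drop i).sum + (τ.take p).sum - d₁)
                (shuffle (σ.drop i) (τ.take p).reverse) *
              sumMult μ t
                (glue (shuffle (σ.take i) (θ.drop j).reverse)
                  ((σ.drop i).sum + (τ.take p).sum - d₁)
                  (shuffle (τ.drop p) (θ.take j).reverse)) +
            sumMult μ ((τ.drop p).sum + (θ.take j).sum - d₂)
                (shuffle (τ.drop p) (θ.take j).reverse) *
              sumMult μ t
                (glue (shuffle (σ.take i) (θ.drop j).reverse)
                  ((τ.drop p).sum + (θ.take j).sum - d₂)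
                  (shuffle (σ.drop i) (τ.take p).reverse)))

/-! ### Depth -/

/-- The depth `d` part of `Lie(V)`, spanned by the iterated brackets of `d` letters. -/
noncomputable def depthPart (d : ℕ) : Submodule ℚ LieV :=
  Submodule.span ℚ {x | ∃ t : FreeMagma ℕ, t.length = d ∧ lieMap (elt t) = x}

/-- The descending depth filtration of `Lie(V)`: the sum of the parts of depth at least `d`. -/
noncomputable def depthFil (d : ℕ) : Submodule ℚ LieV :=
  ⨆ (e : ℕ) (_ : d ≤ e), depthPart e

/-- `T` respects the depth filtration `F`, the product `S` respects the depth grading, and the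
maps `F^p/F^{p+1} × F^q/F^{q+1} → F^{p+q}/F^{p+q+1}` induced by `T` and `S` coincide: `S` is the
associated depth-graded product of `T`. -/
structure IsDepthGradedOf (S T : LieV →ₗ[ℚ] LieV →ₗ[ℚ] LieV) : Prop where
  /-- `T` respects the filtration. -/
  filtered : ∀ p q : ℕ, ∀ x ∈ depthFil p, ∀ y ∈ depthFil q, T x y ∈ depthFil (p + q)
  /-- `S` respects the grading. -/
  graded : ∀ p q : ℕ, ∀ x ∈ depthPart p, ∀ y ∈ depthPart q, S x y ∈ depthPart (p + q)
  /-- `T` and `S` agree on the associated graded space. -/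
  agree : ∀ p q : ℕ, ∀ x ∈ depthFil p, ∀ y ∈ depthFil q, T x y - S x y ∈ depthFil (p + q + 1)

end UriPostLie

/-!
The argument rests on one derivation of the free Lie algebra: the shift `δ` with
`δ v_k = (k - 1) v_{k-1}`. The ari multiplicities are the coefficients of its divided powers: for a
magma element `t = t(𝐤)`, the sum of `m_{𝐤,𝐥} t(𝐥)` over all `𝐥` with `|𝐤 - 𝐥| = n` has the class
`dp n t = (-δ)^n t / n!` in the free Lie algebra (`dp_brk`). Hence, modulo the Lie relations,
`t ▷_a v_a = ∑ₙ ⁅v_{a+n}, dp n t⁆` and `t ▷_u v_a = ∑ₙ ∑_α μ_{a,α} ad_α (dp n t)`, where `α` runs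
over the compositions of `a + n` and `ad_α = ad(v_{α₁}) ∘ ⋯ ∘ ad(v_{α_s})`. The right-hand sides
depend only on the class of `t`, and a derivation of the free Lie algebra with prescribed values on
the letters exists and is unique (`derExt`, `lieDerivation_ext`), so both products descend
(`descendsTo_lieExt`).

For the post-Lie identity, both sides are derivations in the last argument, so it is enough to
evaluate them on a letter `v_a`. The key point is that left multiplications for `▷_u` commute
with `δ`, hence with its divided powers (`uriLie_dp`). This holds for every multiplicity that
depends only on the length and the threshold index, and comes down to how the index reacts to
raising one letter of a word (`sum_thresholdIndex_raise`). Therefore, in `x ▷ (y ▷ v_a)`, the terms where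
`x` acts on a divided power of `y` add up to `(x ▷ y) ▷ v_a`. What remains are the terms where `x` acts
on a letter produced by `y` (`uriGraft`). Expanding them, and `⁅x, y⁆ ▷ v_a`, with the coproduct
dual to the shuffle product (`sum_adw_lie`) into the elements `⁅ad_σ (dp m x), ad_θ (dp n y)⁆`, the
coefficients agree by the threshold shuffle identity for the pair `σ, θ` (`shuffleSum_uriCoeff`).

The statement on depth follows because `ad_α` raises depth by the length of `α`, and the words of
length one contribute the same terms to both products, as `B₁(1, 1) = 1`.
-/

namespace UriPostLie

open FreeMagma Finset

/-! ### Derivations of the free Lie algebra -/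

theorem lieMap_surjective : Function.Surjective lieMap := Quot.mk_surjective

/-- A linear map on the free non-associative algebra which is constant on the relations defining
the free Lie algebra descends to the free Lie algebra. -/
noncomputable def liftLinear {W : Type*} [AddCommGroup W] [Module ℚ W] (g : MagAlg →ₗ[ℚ] W)
    (h : ∀ a b, FreeLieAlgebra.Rel ℚ ℕ a b → g a = g b) : LieV →ₗ[ℚ] W where
  toFun x := Quot.liftOn x g h
  map_add' := by
    rintro ⟨a⟩ ⟨b⟩
    exact map_add g a b
  map_smul' := by
    rintro c ⟨a⟩
    exact map_smul g c a

/-- The image of a magma element in the free Lie algebra: the iterated bracket of its letters. -/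
noncomputable def brk (t : FreeMagma ℕ) : LieV := lieMap (elt t)

theorem elt_mul (s t : FreeMagma ℕ) : elt (s * t) = elt s * elt t := by
  simp [elt, MonoidAlgebra.single_mul_single]

theorem brk_mul (s t : FreeMagma ℕ) : brk (s * t) = ⁅brk s, brk t⁆ := by
  rw [brk, elt_mul, lieMap_mul, brk, brk]

/-- Induction for elements of the free non-associative algebra, as linear combinations of magma
elements. -/
theorem magAlg_induction {p : MagAlg → Prop} (x : MagAlg) (h0 : p 0)
    (hadd : ∀ a b, p a → p b → p (a + b)) (hsmul : ∀ (c : ℚ) a, p a → p (c • a))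
    (helt : ∀ t, p (elt t)) : p x := by
  induction x using MonoidAlgebra.induction_linear with
  | zero => exact h0
  | add a b ha hb => exact hadd a b ha hb
  | single t r =>
    have : (MonoidAlgebra.single t r : MagAlg) = r • elt t := by simp [elt]
    rw [this]
    exact hsmul _ _ (helt t)

theorem lieV_induction {p : LieV → Prop} (x : LieV) (h0 : p 0)
    (hadd : ∀ a b, p a → p b → p (a + b)) (hsmul : ∀ (c : ℚ) a, p a → p (c • a))
    (hbrk : ∀ t, p (brk t)) : p x := by
  obtain ⟨y, rfl⟩ := lieMap_surjective x
  induction y using magAlg_induction with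
  | h0 => simpa using h0
  | hadd a b ha hb => rw [map_add]; exact hadd _ _ ha hb
  | hsmul c a ha => rw [map_smul]; exact hsmul _ _ ha
  | helt t => exact hbrk t

/-- The linear extension to the free non-associative algebra of a map on magma elements. -/
noncomputable def linExt {W : Type*} [AddCommGroup W] [Module ℚ W] (g : FreeMagma ℕ → W) :
    MagAlg →ₗ[ℚ] W :=
  Finsupp.linearCombination ℚ g ∘ₗ (MonoidAlgebra.coeffLinearEquiv ℚ).toLinearMap

theorem linExt_elt {W : Type*} [AddCommGroup W] [Module ℚ W] (g : FreeMagma ℕ → W)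
    (t : FreeMagma ℕ) : linExt g (elt t) = g t := by
  simp [linExt, elt]

/-- The values on iterated brackets of the derivation with values `F` on the letters. -/
noncomputable def treeDer (F : ℕ → LieV) : FreeMagma ℕ → LieV
  | FreeMagma.of a => F a
  | FreeMagma.mul u v => ⁅treeDer F u, brk v⁆ + ⁅brk u, treeDer F v⁆

theorem linExt_treeDer_mul (F : ℕ → LieV) (x y : MagAlg) :
    linExt (treeDer F) (x * y) =
      ⁅linExt (treeDer F) x, lieMap y⁆ + ⁅lieMap x, linExt (treeDer F) y⁆ := by
  induction x using magAlg_induction with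
  | h0 => simp
  | hadd a b ha hb => simp only [add_mul, map_add, ha, hb, add_lie]; abel
  | hsmul c a ha => simp only [smul_mul_assoc, map_smul, ha, smul_lie, smul_add]
  | helt s =>
    induction y using magAlg_induction with
    | h0 => simp
    | hadd a b ha hb => simp only [mul_add, map_add, ha, hb, lie_add]; abel
    | hsmul c a ha => simp only [mul_smul_comm, map_smul, ha, lie_smul, smul_add]
    | helt t => rw [← elt_mul, linExt_elt, linExt_elt, linExt_elt]; rfl

theorem lieMap_eq_of_rel {a b : MagAlg} (h : FreeLieAlgebra.Rel ℚ ℕ a b) : lieMap a = lieMap b :=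
  Quot.sound h

theorem linExt_treeDer_rel (F : ℕ → LieV) (a b : MagAlg) (h : FreeLieAlgebra.Rel ℚ ℕ a b) :
    linExt (treeDer F) a = linExt (treeDer F) b := by
  induction h with
  | lie_self a =>
    rw [linExt_treeDer_mul, map_zero, ← lie_skew (lieMap a), add_neg_cancel]
  | leibniz_lie a b c =>
    simp only [linExt_treeDer_mul, map_add, lieMap_mul, lie_add, add_lie]
    rw [leibniz_lie (linExt (treeDer F) a), leibniz_lie (lieMap a) (linExt (treeDer F) b),
      leibniz_lie (lieMap a) (lieMap b)]
    abel
  | smul c _ ih => rw [map_smul, map_smul, ih]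
  | add_right c _ ih => rw [map_add, map_add, ih]
  | mul_left c h ih => rw [linExt_treeDer_mul, linExt_treeDer_mul, ih, lieMap_eq_of_rel h]
  | mul_right c h ih => rw [linExt_treeDer_mul, linExt_treeDer_mul, ih, lieMap_eq_of_rel h]

/-- The derivation of the free Lie algebra with prescribed values on the letters. -/
noncomputable def derExt (F : ℕ → LieV) : LieDerivation ℚ LieV LieV where
  toLinearMap := liftLinear (linExt (treeDer F)) (linExt_treeDer_rel F)
  leibniz' x y := by
    obtain ⟨x, rfl⟩ := lieMap_surjective x
    obtain ⟨y, rfl⟩ := lieMap_surjective y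
    change linExt (treeDer F) (x * y) =
      ⁅lieMap x, linExt (treeDer F) y⁆ - ⁅lieMap y, linExt (treeDer F) x⁆
    rw [linExt_treeDer_mul, ← lie_skew (lieMap y)]
    abel

theorem derExt_brk (F : ℕ → LieV) (t : FreeMagma ℕ) : derExt F (brk t) = treeDer F t :=
  linExt_elt _ _

theorem derExt_of (F : ℕ → LieV) (a : ℕ) : derExt F (brk (of a)) = F a := derExt_brk _ _

theorem lieDerivation_ext {D E : LieDerivation ℚ LieV LieV}
    (h : ∀ a, D (brk (of a)) = E (brk (of a))) : D = E := by
  ext x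
  induction x using lieV_induction with
  | h0 => simp
  | hadd a b ha hb => rw [map_add, map_add, ha, hb]
  | hsmul c a ha => rw [map_smul, map_smul, ha]
  | hbrk t =>
    induction t with
    | ih1 a => exact h a
    | ih2 s t hs ht =>
      rw [brk_mul, LieDerivation.apply_lie_eq_add, LieDerivation.apply_lie_eq_add, hs, ht]

theorem derExt_add (F G : ℕ → LieV) : derExt (F + G) = derExt F + derExt G :=
  lieDerivation_ext fun a => by simp [derExt_of]

theorem derExt_sub (F G : ℕ → LieV) : derExt (F - G) = derExt F - derExt G :=
  lieDerivation_ext fun a => by simp [derExt_of]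

theorem derExt_smul (c : ℚ) (F : ℕ → LieV) : derExt (c • F) = c • derExt F :=
  lieDerivation_ext fun a => by simp [derExt_of]

/-- The bilinear product on the free Lie algebra whose left multiplications are the derivations
with values `f a x` on the letters `v_a`. -/
noncomputable def lieExt (f : ℕ → LieV →ₗ[ℚ] LieV) : LieV →ₗ[ℚ] LieV →ₗ[ℚ] LieV :=
  LinearMap.mk₂ ℚ (fun x y => derExt (fun a => f a x) y)
    (fun x x' y => by
      have : (fun a => f a (x + x')) = (fun a => f a x) + fun a => f a x' := by
        ext a; simp
      rw [this, derExt_add]; rfl)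
    (fun c x y => by
      have : (fun a => f a (c • x)) = c • fun a => f a x := by
        ext a; simp
      rw [this, derExt_smul]; rfl)
    (fun x y y' => map_add _ y y')
    (fun c x y => map_smul _ c y)

theorem lieExt_apply (f : ℕ → LieV →ₗ[ℚ] LieV) (x y : LieV) :
    lieExt f x y = derExt (fun a => f a x) y := rfl

theorem triExt_elt (f : FreeMagma ℕ → ℕ → MagAlg) (t s : FreeMagma ℕ) :
    triExt f (elt t) (elt s) = triTree f t s := by
  simp [triExt, elt]

/-- A product on the free non-associative algebra descends to the free Lie algebra if its values
on letters are, modulo the Lie relations, functions of the class of the left factor. -/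
theorem descendsTo_lieExt (f : FreeMagma ℕ → ℕ → MagAlg) (g : ℕ → LieV →ₗ[ℚ] LieV)
    (h : ∀ t a, lieMap (f t a) = g a (brk t)) : DescendsTo (triExt f) (lieExt g) := by
  have key : ∀ t s, lieMap (triTree f t s) = treeDer (fun a => g a (brk t)) s := by
    intro t s
    induction s with
    | ih1 a => exact h t a
    | ih2 u v hu hv =>
      change lieMap (triTree f t u * elt v + elt u * triTree f t v) = _
      rw [map_add, lieMap_mul, lieMap_mul, hu, hv]
      rfl
  intro x y
  induction x using magAlg_induction with
  | h0 => simp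
  | hadd a b ha hb => simp only [map_add, LinearMap.add_apply, ha, hb]
  | hsmul c a ha => simp only [map_smul, LinearMap.smul_apply, ha]
  | helt t =>
    induction y using magAlg_induction with
    | h0 => simp
    | hadd a b ha hb => simp only [map_add, ha, hb]
    | hsmul c a ha => simp only [map_smul, ha]
    | helt s => rw [triExt_elt, key, lieExt_apply]; exact (derExt_brk _ _).symm

theorem DescendsTo.unique {tri : MagAlg →ₗ[ℚ] MagAlg →ₗ[ℚ] MagAlg}
    {S T : LieV →ₗ[ℚ] LieV →ₗ[ℚ] LieV} (hS : DescendsTo tri S) (hT : DescendsTo tri T) :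
    S = T := by
  ext x y
  obtain ⟨x, rfl⟩ := lieMap_surjective x
  obtain ⟨y, rfl⟩ := lieMap_surjective y
  rw [← hS, ← hT]

/-! ### The shift derivation and its divided powers -/

/-- The derivation `δ` of `Lie(V)` with `δ v_k = (k - 1) v_{k-1}` for `k ≥ 1` and `δ v_0 = 0`. -/
noncomputable def shiftDer : LieDerivation ℚ LieV LieV :=
  derExt fun k => ((k - 1 : ℕ) : ℚ) • brk (of (k - 1))

theorem shiftDer_of (k : ℕ) : shiftDer (brk (of k)) = ((k - 1 : ℕ) : ℚ) • brk (of (k - 1)) :=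
  derExt_of _ _

/-- The signed divided power `(-δ)^n / n!` of the shift derivation. -/
noncomputable def dp (n : ℕ) : LieV →ₗ[ℚ] LieV :=
  ((-1) ^ n / (n.factorial : ℚ)) • (shiftDer : LieV →ₗ[ℚ] LieV) ^ n

theorem dp_apply (n : ℕ) (x : LieV) :
    dp n x = ((-1) ^ n / (n.factorial : ℚ)) • shiftDer^[n] x := by
  simp [dp, Module.End.pow_apply]

theorem shiftDer_dp (n : ℕ) (x : LieV) :
    shiftDer (dp n x) = -((n + 1 : ℕ) : ℚ) • dp (n + 1) x := by
  rw [dp_apply, dp_apply, map_smul, Function.iterate_succ_apply', smul_smul]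
  congr 1
  rw [Nat.factorial_succ, pow_succ]
  have : (n.factorial : ℚ) ≠ 0 := by positivity
  push_cast
  have h2 : (n : ℚ) + 1 ≠ 0 := by positivity
  field_simp

theorem dp_lie (n : ℕ) (x y : LieV) :
    dp n ⁅x, y⁆ = ∑ ij ∈ antidiagonal n, ⁅dp ij.1 x, dp ij.2 y⁆ := by
  rw [dp_apply, LieDerivation.iterate_apply_lie, smul_sum]
  refine sum_congr rfl fun ij hij => ?_
  obtain rfl := mem_antidiagonal.1 hij
  rw [dp_apply, dp_apply, smul_lie, lie_smul, smul_smul, ← Nat.cast_smul_eq_nsmul ℚ, smul_smul]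
  congr 1
  have h := Nat.choose_mul_factorial_mul_factorial (Nat.le_add_right ij.1 ij.2)
  rw [Nat.add_sub_cancel_left] at h
  have h' : ((ij.1 + ij.2).choose ij.1 : ℚ) * ij.1.factorial * ij.2.factorial =
      (ij.1 + ij.2).factorial := by exact_mod_cast h
  rw [← h', pow_add]
  have h1 : (ij.1.factorial : ℚ) ≠ 0 := by positivity
  have h2 : (ij.2.factorial : ℚ) ≠ 0 := by positivity
  have h3 : ((ij.1 + ij.2).choose ij.1 : ℚ) ≠ 0 := by
    exact_mod_cast (Nat.choose_pos (Nat.le_add_right _ _)).ne'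
  field_simp

theorem iterate_shiftDer_of (n k : ℕ) :
    shiftDer^[n] (brk (of k)) = ((k - 1).descFactorial n : ℚ) • brk (of (k - n)) := by
  induction n with
  | zero => simp
  | succ n ih =>
    rw [Function.iterate_succ_apply', ih, map_smul, shiftDer_of, smul_smul,
      Nat.descFactorial_succ, Nat.sub_sub, Nat.sub_sub, Nat.add_comm 1 n]
    push_cast
    rw [mul_comm]

theorem dp_of (n k : ℕ) :
    dp n (brk (of k)) = ((-1) ^ n * ((k - 1).choose n : ℚ)) • brk (of (k - n)) := by
  rw [dp_apply, iterate_shiftDer_of, smul_smul, Nat.descFactorial_eq_factorial_mul_choose]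
  congr 1
  have h1 : (n.factorial : ℚ) ≠ 0 := by positivity
  push_cast
  field_simp

theorem ariMult_append {m n : ℕ} (k k' : Fin m → ℕ) (l l' : Fin n → ℕ) :
    ariMult (Fin.append k l) (Fin.append k' l') = ariMult k k' * ariMult l l' := by
  simp only [ariMult, Fin.sum_univ_add, Fin.prod_univ_add, Fin.append_left, Fin.append_right]
  rw [show ∀ a b c d : ℕ, a + b + (c + d) = (a + c) + (b + d) by intros; omega, pow_add]
  ring

theorem sum_sub_append {m n : ℕ} (k k' : Fin m → ℕ) (l l' : Fin n → ℕ) :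
    ∑ i, (Fin.append k l i - Fin.append k' l' i) = ∑ i, (k i - k' i) + ∑ i, (l i - l' i) := by
  simp only [Fin.sum_univ_add, Fin.append_left, Fin.append_right]

theorem relabel_append (x y : FreeMagma ℕ) (k : Fin x.length → ℕ) (l : Fin y.length → ℕ) :
    relabel (x * y) (Fin.append k l) = relabel x k * relabel y l := by
  change relabel x (fun i => Fin.append k l (Fin.castAdd y.length i)) *
    relabel y (fun i => Fin.append k l (Fin.natAdd x.length i)) = _
  simp only [Fin.append_left, Fin.append_right]

/-- The labels `𝐥 ≤ 𝐤` of a product `x ⋆ y` are the pairs of labels of `x` and `y`. -/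
theorem sum_Iic_append {M : Type*} [AddCommMonoid M] {m n : ℕ} (k : Fin m → ℕ) (l : Fin n → ℕ)
    (f : (Fin (m + n) → ℕ) → M) :
    ∑ r ∈ Iic (Fin.append k l), f r = ∑ p ∈ Iic k, ∑ q ∈ Iic l, f (Fin.append p q) := by
  rw [← sum_product']
  symm
  refine sum_bij' (fun p _ => Fin.append p.1 p.2)
    (fun r _ => (fun i => r (Fin.castAdd n i), fun i => r (Fin.natAdd m i))) ?_ ?_ ?_ ?_ ?_
  · intro p hp
    simp only [mem_product, mem_Iic, Pi.le_def] at hp ⊢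
    intro i
    refine Fin.addCases (fun i => ?_) (fun i => ?_) i
    · simpa using hp.1 i
    · simpa using hp.2 i
  · intro r hr
    simp only [mem_product, mem_Iic, Pi.le_def] at hr ⊢
    exact ⟨fun i => by simpa using hr (Fin.castAdd n i),
      fun i => by simpa using hr (Fin.natAdd m i)⟩
  · intro p _
    simp
  · intro r _
    exact Fin.append_castAdd_natAdd
  · intro p _
    rfl

/-- The divided powers of the shift derivation collect the terms `m_{𝐤,𝐥} t(𝐥)` with
`|𝐤 - 𝐥| = n`. -/
theorem dp_brk (t : FreeMagma ℕ) (n : ℕ) :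
    dp n (brk t) = ∑ l ∈ Iic (leaves t),
      if ∑ i, (leaves t i - l i) = n then ariMult (leaves t) l • brk (relabel t l) else 0 := by
  induction t generalizing n with
  | ih1 a =>
    have h1 : ∀ f : (Fin (of a : FreeMagma ℕ).length → ℕ) → LieV,
        ∑ l ∈ Iic (leaves (of a)), f l = ∑ j ∈ Iic a, f (fun _ => j) := by
      intro f
      symm
      refine sum_bij' (fun j _ => fun _ => j) (fun l _ => l ⟨0, Nat.one_pos⟩) ?_ ?_ ?_ ?_ ?_
      · intro j hj
        exact mem_Iic.2 fun _ => mem_Iic.1 hj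
      · intro l hl
        simp only [mem_Iic, Pi.le_def] at hl ⊢
        exact hl _
      · intro j _; rfl
      · intro l _
        funext i
        have : i = ⟨0, Nat.one_pos⟩ := Subsingleton.elim (α := Fin 1) _ _
        rw [this]
      · intro j _; rfl
    rw [h1, dp_of]
    have h2 : ∀ j : ℕ, ∑ i : Fin (of a : FreeMagma ℕ).length, (leaves (of a) i - j) = a - j := by
      intro j
      exact Fin.sum_univ_one (fun i : Fin 1 => a - j)
    have h3 : ∀ j : ℕ, ariMult (leaves (of a)) (fun _ => j) = (-1) ^ (a + j) * predChoose a j := by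
      intro j
      have e1 := Fin.sum_univ_one (fun _ : Fin 1 => a)
      have e2 := Fin.sum_univ_one (fun _ : Fin 1 => j)
      have e3 := Fin.prod_univ_one (fun _ : Fin 1 => (predChoose a j : ℚ))
      change (-1 : ℚ) ^ (∑ i : Fin 1, a + ∑ i : Fin 1, j) * ∏ i : Fin 1, (predChoose a j : ℚ) = _
      rw [e1, e2, e3]
    simp only [h2, h3]
    by_cases hn : n ≤ a
    · rw [sum_eq_single (a - n)]
      · rw [if_pos (by omega)]
        change _ = _ • brk (of (a - n))
        congr 1
        have e : a + (a - n) = n + 2 * (a - n) := by omega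
        rw [e, pow_add, pow_mul]
        norm_num
        rcases Nat.eq_zero_or_pos a with rfl | ha
        · obtain rfl : n = 0 := by omega
          rfl
        · rcases Nat.eq_or_lt_of_le hn with rfl | hlt
          · obtain ⟨b, rfl⟩ := Nat.exists_eq_succ_of_ne_zero ha.ne'
            simp [predChoose]
          · obtain ⟨b, rfl⟩ := Nat.exists_eq_succ_of_ne_zero ha.ne'
            obtain ⟨c, hc⟩ : ∃ c, b + 1 - n = c + 1 := ⟨b - n, by omega⟩
            change _ = predChoose (b + 1) (b + 1 - n)
            rw [hc]
            simp only [predChoose, Nat.succ_eq_add_one, Nat.add_sub_cancel]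
            rw [← Nat.choose_symm (by omega)]
            congr 1
            omega
      · intro j hj hne
        rw [mem_Iic] at hj
        rw [if_neg (by omega)]
      · intro h
        simp at h
    · rw [Nat.choose_eq_zero_of_lt (by omega), sum_eq_zero]
      · simp
      · intro j hj
        rw [if_neg (by omega)]
  | ih2 x y hx hy =>
    rw [brk_mul, dp_lie]
    change _ = ∑ l ∈ Iic (Fin.append (leaves x) (leaves y)),
      if ∑ i, (Fin.append (leaves x) (leaves y) i - l i) = n then
        ariMult (Fin.append (leaves x) (leaves y)) l • brk (relabel (x * y) l) else 0
    rw [sum_Iic_append]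
    simp only [ariMult_append, sum_sub_append, relabel_append, brk_mul, hx, hy,
      sum_lie, lie_sum]
    rw [sum_comm]
    refine (sum_congr rfl fun q _ => sum_comm).trans (sum_comm.trans ?_)
    refine sum_congr rfl fun p _ => sum_congr rfl fun q _ => ?_
    generalize ∑ i, (leaves x i - p i) = u
    generalize ∑ i, (leaves y i - q i) = v
    have h : ∀ ij ∈ antidiagonal n, ij ≠ (u, v) →
        ⁅if u = ij.1 then ariMult (leaves x) p • brk (relabel x p) else 0,
          if v = ij.2 then ariMult (leaves y) q • brk (relabel y q) else 0⁆ = 0 := by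
      rintro ⟨i, j⟩ _ hne
      by_cases hu : u = i
      · have hv : v ≠ j := by
          rintro rfl
          exact hne (by rw [hu])
        rw [if_neg hv, lie_zero]
      · rw [if_neg hu, zero_lie]
    -- At most the pair `(u, v)` of the antidiagonal contributes.
    by_cases huv : u + v = n
    · rw [sum_eq_single_of_mem (u, v) (mem_antidiagonal.2 huv) h, if_pos rfl, if_pos rfl,
        if_pos huv, smul_lie, lie_smul, smul_smul]
    · rw [if_neg huv]
      refine sum_eq_zero fun ij hij => h ij hij ?_
      rintro rfl
      exact huv (mem_antidiagonal.1 hij)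

/-! ### Sums over words of positive letters -/

/-- The words of positive letters with sum at most `M`. -/
def words (M : ℕ) : Finset (List ℕ) :=
  (range (M + 1)).biUnion fun k => univ.image fun α : Composition k => α.blocks

theorem mem_words {M : ℕ} {α : List ℕ} : α ∈ words M ↔ (∀ x ∈ α, 0 < x) ∧ α.sum ≤ M := by
  simp only [words, mem_biUnion, mem_range, mem_image, mem_univ, true_and]
  constructor
  · rintro ⟨k, hk, β, rfl⟩
    exact ⟨fun x hx => β.blocks_pos hx, by rw [β.blocks_sum]; omega⟩
  · rintro ⟨h, hs⟩
    exact ⟨α.sum, by omega, ⟨α, fun {i} hi => h i hi, rfl⟩, rfl⟩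

theorem sum_composition {W : Type*} [AddCommMonoid W] (f : List ℕ → W) {k M : ℕ} (h : k ≤ M) :
    ∑ α : Composition k, f α.blocks = ∑ α ∈ words M, if α.sum = k then f α else 0 := by
  rw [← sum_filter]
  refine sum_bij (fun α _ => α.blocks) ?_ ?_ ?_ ?_
  · intro α _
    rw [mem_filter, mem_words, α.blocks_sum]
    exact ⟨⟨fun x hx => α.blocks_pos hx, h⟩, rfl⟩
  · intro α _ β _ hαβ
    exact Composition.ext hαβ
  · intro α hα
    rw [mem_filter, mem_words] at hα
    exact ⟨⟨α, fun {i} hi => hα.1.1 i hi, hα.2⟩, mem_univ _, rfl⟩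
  · intro α _
    rfl

/-- Summing over all decompositions of all words is summing over all pairs of words. The bound
`M` on the sums is harmless for summands supported on pairs of total sum at most `M`. -/
theorem sum_words_split {W : Type*} [AddCommMonoid W] (M : ℕ) (f : List ℕ → List ℕ → W)
    (hf : ∀ u v, M < u.sum + v.sum → f u v = 0) :
    ∑ α ∈ words M, ∑ i ∈ range (α.length + 1), f (α.take i) (α.drop i) =
      ∑ u ∈ words M, ∑ v ∈ words M, f u v := by
  rw [← sum_product', ← sum_filter_of_ne (s := words M ×ˢ words M)
    (p := fun p => p.1.sum + p.2.sum ≤ M), sum_sigma']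
  · refine sum_bij' (fun p _ => (p.1.take p.2, p.1.drop p.2))
      (fun q _ => ⟨q.1 ++ q.2, q.1.length⟩) ?_ ?_ ?_ ?_ ?_
    · rintro ⟨α, i⟩ h
      simp only [mem_sigma, mem_words, mem_range, mem_filter, mem_product] at h ⊢
      have hs : (α.take i).sum + (α.drop i).sum = α.sum := by
        rw [← List.sum_append, List.take_append_drop]
      exact ⟨⟨⟨fun x hx => h.1.1 x (List.mem_of_mem_take hx), by omega⟩,
        ⟨fun x hx => h.1.1 x (List.mem_of_mem_drop hx), by omega⟩⟩, by omega⟩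
    · rintro ⟨u, v⟩ h
      simp only [mem_sigma, mem_words, mem_range, mem_filter, mem_product, List.mem_append,
        List.sum_append, List.length_append] at h ⊢
      exact ⟨⟨fun x hx => hx.elim (h.1.1.1 x) (h.1.2.1 x), h.2⟩, by omega⟩
    · rintro ⟨α, i⟩ h
      simp only [mem_sigma, mem_range] at h
      simp only [List.take_append_drop, List.length_take]
      rw [min_eq_left (by omega)]
    · rintro ⟨u, v⟩ _
      simp
    · rintro ⟨α, i⟩ _
      rfl
  · rintro ⟨u, v⟩ _ h
    by_contra hlt
    exact h (hf u v (by simpa using hlt))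

/-- Summing over all words with a marked letter is summing over the letter and the words before and
after it. -/
theorem sum_words_split_letter {W : Type*} [AddCommMonoid W] (M : ℕ)
    (f : List ℕ → ℕ → List ℕ → W)
    (hf : ∀ u b v, M < u.sum + b + v.sum → f u b v = 0) :
    ∑ α ∈ words M, ∑ i ∈ range α.length, f (α.take i) (α.getD i 0) (α.drop (i + 1)) =
      ∑ u ∈ words M, ∑ b ∈ Icc 1 M, ∑ v ∈ words M, f u b v := by
  have e : ∑ u ∈ words M, ∑ b ∈ Icc 1 M, ∑ v ∈ words M, f u b v =
      ∑ p ∈ words M ×ˢ (Icc 1 M ×ˢ words M), f p.1 p.2.1 p.2.2 := by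
    rw [sum_product]
    refine sum_congr rfl fun u _ => ?_
    rw [sum_product]
  rw [e, ← sum_filter_of_ne (s := words M ×ˢ (Icc 1 M ×ˢ words M))
    (p := fun p => p.1.sum + p.2.1 + p.2.2.sum ≤ M), sum_sigma']
  · refine sum_bij' (fun p _ => (p.1.take p.2, p.1.getD p.2 0, p.1.drop (p.2 + 1)))
      (fun q _ => ⟨q.1 ++ q.2.1 :: q.2.2, q.1.length⟩) ?_ ?_ ?_ ?_ ?_
    · rintro ⟨α, i⟩ h
      simp only [mem_sigma, mem_words, mem_range, mem_filter, mem_product, mem_Icc] at h ⊢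
      have hg : α.getD i 0 = α[i]'h.2 := List.getD_eq_getElem _ _ h.2
      have hd : α.drop i = α.getD i 0 :: α.drop (i + 1) := by
        rw [hg]; exact List.drop_eq_getElem_cons h.2
      have hs : (α.take i).sum + (α.getD i 0 + (α.drop (i + 1)).sum) = α.sum := by
        rw [← List.sum_cons, ← hd, ← List.sum_append, List.take_append_drop]
      have hp : 0 < α.getD i 0 := by rw [hg]; exact h.1.1 _ (List.getElem_mem _)
      exact ⟨⟨⟨fun x hx => h.1.1 x (List.mem_of_mem_take hx), by omega⟩, ⟨hp, by omega⟩,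
        ⟨fun x hx => h.1.1 x (List.mem_of_mem_drop hx), by omega⟩⟩, by omega⟩
    · rintro ⟨u, b, v⟩ h
      simp only [mem_sigma, mem_words, mem_range, mem_filter, mem_product, mem_Icc,
        List.mem_append, List.mem_cons, List.sum_append, List.sum_cons, List.length_append,
        List.length_cons] at h ⊢
      refine ⟨⟨?_, by omega⟩, by omega⟩
      rintro x (hx | rfl | hx)
      · exact h.1.1.1 x hx
      · exact h.1.2.1.1
      · exact h.1.2.2.1 x hx
    · rintro ⟨α, i⟩ h
      simp only [mem_sigma, mem_range] at h
      have hd : α.drop i = α.getD i 0 :: α.drop (i + 1) := by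
        rw [List.getD_eq_getElem _ _ h.2]; exact List.drop_eq_getElem_cons h.2
      simp only [← hd, List.take_append_drop, List.length_take]
      rw [min_eq_left (by omega)]
    · rintro ⟨u, b, v⟩ _
      simp [List.drop_append]
    · rintro ⟨α, i⟩ _
      rfl
  · rintro ⟨u, b, v⟩ _ h
    by_contra hlt
    exact h (hf u b v (by simpa using hlt))

theorem sum_words_cons {W : Type*} [AddCommMonoid W] (M : ℕ)
    (f : List ℕ → W) (hf : ∀ u, M < u.sum → f u = 0) :
    ∑ α ∈ words M, f α = f [] + ∑ b ∈ Icc 1 M, ∑ α ∈ words M, f (b :: α) := by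
  have h0 : [] ∈ words M := mem_words.2 ⟨by simp, by simp⟩
  rw [← add_sum_erase _ _ h0]
  congr 1
  rw [← sum_product', ← sum_filter_of_ne (s := Icc 1 M ×ˢ words M)
    (p := fun p => p.1 + p.2.sum ≤ M)]
  · symm
    refine sum_bij (fun p _ => p.1 :: p.2) ?_ ?_ ?_ ?_
    · rintro ⟨b, v⟩ h
      simp only [mem_words, mem_filter, mem_product, mem_Icc, mem_erase, List.mem_cons,
        List.sum_cons] at h ⊢
      refine ⟨List.cons_ne_nil _ _, ?_, h.2⟩
      rintro x (rfl | hx)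
      · exact h.1.1.1
      · exact h.1.2.1 x hx
    · rintro ⟨b, v⟩ _ ⟨b', v'⟩ _ h
      simpa using h
    · intro α hα
      rw [mem_erase, mem_words] at hα
      cases α with
      | nil => exact absurd rfl hα.1
      | cons b v =>
        simp only [List.mem_cons, List.sum_cons] at hα
        have := hα.2.1 b (Or.inl rfl)
        refine ⟨(b, v), ?_, rfl⟩
        simp only [mem_words, mem_filter, mem_product, mem_Icc]
        exact ⟨⟨⟨this, by omega⟩, fun x hx => hα.2.1 x (Or.inr hx), by omega⟩, hα.2.2⟩
    · rintro ⟨b, v⟩ _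
      rfl
  · rintro ⟨b, v⟩ _ h
    by_contra hlt
    exact h (hf _ (by simpa using hlt))

/-! ### Words acting on the free Lie algebra -/

/-- The operator `ad(v_{α₁}) ∘ ⋯ ∘ ad(v_{α_s})` attached to a word `α`. -/
noncomputable def adw : List ℕ → Module.End ℚ LieV
  | [] => 1
  | b :: α => (LieAlgebra.ad ℚ LieV (brk (of b))).comp (adw α)

theorem adw_nil (x : LieV) : adw [] x = x := rfl

theorem adw_cons (b : ℕ) (α : List ℕ) (x : LieV) : adw (b :: α) x = ⁅brk (of b), adw α x⁆ := rfl

theorem adw_append (α β : List ℕ) (x : LieV) : adw (α ++ β) x = adw α (adw β x) := by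
  induction α with
  | nil => rfl
  | cons b α ih => rw [List.cons_append, adw_cons, adw_cons, ih]

theorem brk_nest (α : List ℕ) (t : FreeMagma ℕ) : brk (nest α t) = adw α (brk t) := by
  induction α with
  | nil => rfl
  | cons b α ih =>
    change brk (of b * nest α t) = _
    rw [brk_mul, ih, adw_cons]

/-- The Leibniz rule for `⁅v_{α₁}, ⁅v_{α₂}, …, x⁆⁆`. -/
theorem lieDerivation_adw (D : LieDerivation ℚ LieV LieV) (α : List ℕ) (x : LieV) :
    D (adw α x) = adw α (D x) + ∑ i ∈ range α.length,
      adw (α.take i) ⁅D (brk (of (α.getD i 0))), adw (α.drop (i + 1)) x⁆ := by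
  induction α with
  | nil => simp [adw_nil]
  | cons b α ih =>
    rw [adw_cons, LieDerivation.apply_lie_eq_add, ih, List.length_cons, sum_range_succ']
    simp only [List.take_succ_cons, List.getD_cons_succ, List.drop_succ_cons, List.take_zero,
      List.getD_cons_zero, List.drop_zero, adw_cons, adw_nil, lie_add, lie_sum]
    abel

/-! ### Shuffles -/

/-- The sum of `c` over the shuffles of two words. -/
def shuffleSum (c : List ℕ → ℚ) (σ θ : List ℕ) : ℚ := ((shuffle σ θ).map c).sum

theorem sum_of_mem_shuffle {σ θ w : List ℕ} (h : w ∈ shuffle σ θ) : w.sum = σ.sum + θ.sum := by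
  induction σ, θ using shuffle.induct generalizing w with
  | case1 bs => simp_all [shuffle]
  | case2 a as => simp_all [shuffle]
  | case3 a as b bs h1 h2 =>
    simp only [shuffle, List.mem_append, List.mem_map] at h
    rcases h with ⟨w, hw, rfl⟩ | ⟨w, hw, rfl⟩
    · have := h1 hw
      simp only [List.sum_cons] at this ⊢
      omega
    · have := h2 hw
      simp only [List.sum_cons] at this ⊢
      omega

theorem shuffle_perm (σ θ : List ℕ) : (shuffle σ θ).Perm (shuffle θ σ) := by
  induction σ, θ using shuffle.induct with
  | case1 bs => cases bs <;> simp [shuffle]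
  | case2 a as => simp [shuffle]
  | case3 a as b bs h1 h2 =>
    simp only [shuffle]
    exact ((h1.map _).append (h2.map _)).trans List.perm_append_comm

theorem shuffleSum_comm (c : List ℕ → ℚ) (σ θ : List ℕ) :
    shuffleSum c σ θ = shuffleSum c θ σ :=
  ((shuffle_perm σ θ).map c).sum_eq

theorem shuffleSum_eq_zero {c : List ℕ → ℚ} {σ θ : List ℕ}
    (h : ∀ w : List ℕ, w.sum = σ.sum + θ.sum → c w = 0) : shuffleSum c σ θ = 0 := by
  refine List.sum_eq_zero fun x hx => ?_
  obtain ⟨w, hw, rfl⟩ := List.mem_map.1 hx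
  exact h w (sum_of_mem_shuffle hw)

theorem shuffleSum_congr {c d : List ℕ → ℚ} {σ θ : List ℕ}
    (h : ∀ w : List ℕ, w.sum = σ.sum + θ.sum → c w = d w) :
    shuffleSum c σ θ = shuffleSum d σ θ := by
  unfold shuffleSum
  congr 1
  exact List.map_congr_left fun w hw => h w (sum_of_mem_shuffle hw)

/-- The part of a sum over shuffles in which the first letter comes from the first word. -/
def shuffleSumFst (c : List ℕ → ℚ) : List ℕ → List ℕ → ℚ
  | [], _ => 0
  | b :: σ, θ => shuffleSum (fun w => c (b :: w)) σ θ

/-- Shuffles are sorted by the word that their first letter comes from. Unlike the recursive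
definition, this form treats the two words symmetrically, empty words included. -/
theorem shuffleSum_eq (c : List ℕ → ℚ) (σ θ : List ℕ) :
    shuffleSum c σ θ = (if σ = [] then if θ = [] then c [] else 0 else 0) +
      shuffleSumFst c σ θ + shuffleSumFst c θ σ := by
  have hl : ∀ w, shuffle w [] = [w] := fun w => by cases w <;> simp [shuffle]
  cases σ with
  | nil => cases θ <;> simp [shuffleSumFst, shuffleSum, shuffle, hl]
  | cons a σ =>
    cases θ with
    | nil => simp [shuffleSumFst, shuffleSum, hl]
    | cons b θ =>
      have h := shuffleSum_comm (fun w => c (b :: w)) (a :: σ) θ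
      simp only [shuffleSumFst]
      rw [← h]
      simp [shuffleSum, shuffle, Function.comp_def]

theorem shuffleSumFst_eq_zero {c : List ℕ → ℚ} {σ θ : List ℕ}
    (h : ∀ w : List ℕ, w.sum = σ.sum + θ.sum → c w = 0) : shuffleSumFst c σ θ = 0 := by
  cases σ with
  | nil => rfl
  | cons b σ =>
    refine shuffleSum_eq_zero fun w hw => h _ ?_
    rw [List.sum_cons, hw, List.sum_cons, add_assoc]

/-- Words act on a bracket through the deconcatenation dual to the shuffle product, because each
`ad(v_i)` is a derivation. -/
theorem sum_adw_lie (M : ℕ) (c : List ℕ → ℚ) (hc : ∀ w : List ℕ, M < w.sum → c w = 0)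
    (x y : LieV) :
    ∑ α ∈ words M, c α • adw α ⁅x, y⁆ =
      ∑ σ ∈ words M, ∑ θ ∈ words M, shuffleSum c σ θ • ⁅adw σ x, adw θ y⁆ := by
  -- Letters are positive, so removing the first one lowers the bound `N` on the support of `c`.
  suffices H : ∀ N ≤ M + 1, ∀ c : List ℕ → ℚ, (∀ w : List ℕ, N ≤ w.sum → c w = 0) →
      ∑ α ∈ words M, c α • adw α ⁅x, y⁆ =
        ∑ σ ∈ words M, ∑ θ ∈ words M, shuffleSum c σ θ • ⁅adw σ x, adw θ y⁆ from
    H (M + 1) le_rfl c fun w hw => hc w hw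
  intro N
  induction N with
  | zero =>
    intro _ c hc
    have h : ∀ w, c w = 0 := fun w => hc w (Nat.zero_le _)
    simp [h, shuffleSum_eq_zero]
  | succ N ih =>
    intro hN c hc
    have hcM : ∀ w : List ℕ, M < w.sum → c w = 0 := fun w hw => hc w (by omega)
    have h0 : [] ∈ words M := mem_words.2 ⟨by simp, by simp⟩
    have hl : ∑ α ∈ words M, c α • adw α ⁅x, y⁆ = c [] • ⁅x, y⁆ +
        ∑ b ∈ Icc 1 M, ∑ σ ∈ words M, ∑ θ ∈ words M, shuffleSum (fun w => c (b :: w)) σ θ •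
          (⁅adw (b :: σ) x, adw θ y⁆ + ⁅adw σ x, adw (b :: θ) y⁆) := by
      rw [sum_words_cons M _ fun u hu => by rw [hcM u hu, zero_smul]]
      refine congrArg₂ _ rfl (sum_congr rfl fun b hb => ?_)
      rw [mem_Icc] at hb
      have := congrArg (fun z => ⁅brk (of b), z⁆) (ih (by omega) (fun w => c (b :: w))
        fun w hw => hc _ (by rw [List.sum_cons]; omega))
      simp only [lie_sum, lie_smul] at this
      simp only [adw_cons]
      rw [this]
      refine sum_congr rfl fun σ _ => sum_congr rfl fun θ _ => ?_
      rw [leibniz_lie]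
    have hr1 : ∑ σ ∈ words M, ∑ θ ∈ words M, shuffleSumFst c σ θ • ⁅adw σ x, adw θ y⁆ =
        ∑ b ∈ Icc 1 M, ∑ σ ∈ words M, ∑ θ ∈ words M,
          shuffleSum (fun w => c (b :: w)) σ θ • ⁅adw (b :: σ) x, adw θ y⁆ := by
      rw [sum_words_cons M]
      · simp [shuffleSumFst]
      · intro u hu
        refine sum_eq_zero fun θ _ => ?_
        rw [shuffleSumFst_eq_zero fun w hw => hcM w (by omega), zero_smul]
    have hr2 : ∑ σ ∈ words M, ∑ θ ∈ words M, shuffleSumFst c θ σ • ⁅adw σ x, adw θ y⁆ =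
        ∑ b ∈ Icc 1 M, ∑ σ ∈ words M, ∑ θ ∈ words M,
          shuffleSum (fun w => c (b :: w)) σ θ • ⁅adw σ x, adw (b :: θ) y⁆ := by
      rw [sum_comm (s := Icc 1 M)]
      refine sum_congr rfl fun σ _ => ?_
      rw [sum_words_cons M]
      · simp [shuffleSumFst, shuffleSum_comm _ σ]
      · intro u hu
        rw [shuffleSumFst_eq_zero fun w hw => hcM w (by omega), zero_smul]
    have hr0 : ∑ σ ∈ words M, ∑ θ ∈ words M,
        (if σ = [] then if θ = [] then c [] else 0 else 0) • ⁅adw σ x, adw θ y⁆ =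
          c [] • ⁅x, y⁆ := by
      rw [sum_eq_single_of_mem [] h0 fun σ _ hσ => by simp [hσ],
        sum_eq_single_of_mem [] h0 fun θ _ hθ => by simp [hθ]]
      simp [adw_nil]
    have hr : ∑ σ ∈ words M, ∑ θ ∈ words M, shuffleSum c σ θ • ⁅adw σ x, adw θ y⁆ =
        ∑ σ ∈ words M, ∑ θ ∈ words M,
          ((if σ = [] then if θ = [] then c [] else 0 else 0) • ⁅adw σ x, adw θ y⁆ +
            shuffleSumFst c σ θ • ⁅adw σ x, adw θ y⁆ +
              shuffleSumFst c θ σ • ⁅adw σ x, adw θ y⁆) :=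
      sum_congr rfl fun σ _ => sum_congr rfl fun θ _ => by
        rw [shuffleSum_eq c σ θ, add_smul, add_smul]
    rw [hl, hr]
    simp only [sum_add_distrib, smul_add]
    rw [hr0, hr1, hr2, add_assoc]

/-! ### Threshold indices -/

theorem thresholdIndex_nil (a : ℕ) : thresholdIndex a [] = 0 := by
  rw [thresholdIndex, dif_neg]
  rintro ⟨j, h1, h2, -⟩
  simp only [List.length_nil] at h2
  omega

/-- The threshold index, computed from left to right. The value `0` means that there is no index. -/
theorem thresholdIndex_cons (a b : ℕ) (α : List ℕ) :
    thresholdIndex a (b :: α) = if a ≤ b then 1 else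
      if thresholdIndex (a - b) α = 0 then 0 else thresholdIndex (a - b) α + 1 := by
  classical
  by_cases hab : a ≤ b
  · have h : ∃ j, 1 ≤ j ∧ j ≤ (b :: α).length ∧ a ≤ ((b :: α).take j).sum :=
      ⟨1, le_rfl, by simp, by simpa using hab⟩
    rw [if_pos hab, thresholdIndex, dif_pos h, Nat.find_eq_iff]
    exact ⟨⟨le_rfl, by simp, by simpa using hab⟩, fun n hn hn' => by omega⟩
  · rw [if_neg hab]
    by_cases h : ∃ j, 1 ≤ j ∧ j ≤ α.length ∧ a - b ≤ (α.take j).sum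
    · have hf := Nat.find_spec h
      have h' : ∃ j, 1 ≤ j ∧ j ≤ (b :: α).length ∧ a ≤ ((b :: α).take j).sum := by
        refine ⟨Nat.find h + 1, by omega, ?_, ?_⟩
        · rw [List.length_cons]; omega
        · rw [List.take_succ_cons, List.sum_cons]; omega
      have e : thresholdIndex (a - b) α = Nat.find h := by
        rw [thresholdIndex, dif_pos h]
      rw [e, if_neg (by omega), thresholdIndex, dif_pos h', Nat.find_eq_iff]
      refine ⟨⟨by omega, ?_, ?_⟩, ?_⟩
      · rw [List.length_cons]; omega
      · rw [List.take_succ_cons, List.sum_cons]; omega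
      · rintro (_ | n) hn ⟨h1, h2, h3⟩
        · omega
        · rw [List.take_succ_cons, List.sum_cons] at h3
          rw [List.length_cons] at h2
          rcases Nat.eq_zero_or_pos n with rfl | hn0
          · simp only [List.take_zero, List.sum_nil] at h3
            omega
          · exact Nat.find_min h (m := n) (by omega) ⟨hn0, by omega, by omega⟩
    · have e : thresholdIndex (a - b) α = 0 := by
        rw [thresholdIndex, dif_neg h]
      rw [e, if_pos rfl, thresholdIndex, dif_neg]
      rintro ⟨_ | n, h1, h2, h3⟩
      · omega
      · rw [List.take_succ_cons, List.sum_cons] at h3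
        rw [List.length_cons] at h2
        rcases Nat.eq_zero_or_pos n with rfl | hn0
        · simp only [List.take_zero, List.sum_nil] at h3
          omega
        · exact h ⟨n, hn0, by omega, by omega⟩

theorem sum_range_getD (α : List ℕ) :
    ∑ i ∈ range α.length, (α.getD i 0 : ℚ) = (α.sum : ℚ) := by
  induction α with
  | nil => simp
  | cons b α ih =>
    rw [List.length_cons, sum_range_succ']
    simp only [List.getD_cons_succ, List.getD_cons_zero, ih, List.sum_cons]
    push_cast
    ring

/-- Raising the letters of a word one at a time, weighted by their values: how the threshold index
reacts. Raising a letter weakly before the threshold for `a - 1` gives the index for `a - 1`, and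
raising a later one gives the index for `a`. -/
theorem sum_thresholdIndex_raise (β : List ℕ) (hβ : ∀ x ∈ β, 0 < x) (a n : ℕ) (ha : 1 ≤ a)
    (h : β.sum + 1 = a + n) (F : ℕ → ℚ) (hF : F 0 = 0) :
    ∑ i ∈ range β.length, (β.getD i 0 : ℚ) *
        F (thresholdIndex a (β.take i ++ (β.getD i 0 + 1) :: β.drop (i + 1))) =
      n * F (thresholdIndex a β) + ((a - 1 : ℕ) : ℚ) * F (thresholdIndex (a - 1) β) := by
  induction β generalizing a F with
  | nil => simp [thresholdIndex_nil, hF]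
  | cons b β ih =>
    rw [List.length_cons, sum_range_succ']
    simp only [List.getD_cons_succ, List.getD_cons_zero, List.take_succ_cons, List.drop_succ_cons,
      List.cons_append, List.take_zero, List.drop_zero, List.nil_append]
    rw [List.sum_cons] at h
    by_cases hab : a ≤ b
    · simp only [thresholdIndex_cons, if_pos hab, if_pos (show a ≤ b + 1 by omega),
        if_pos (show a - 1 ≤ b by omega)]
      rw [← sum_mul, sum_range_getD, ← add_mul, ← add_mul]
      congr 1
      norm_cast
      omega
    · -- Past the first letter, the threshold drops by `b` and the index by one.
      obtain ⟨F', hF0, hF'⟩ : ∃ F' : ℕ → ℚ, F' 0 = 0 ∧ ∀ (c d : ℕ) (γ : List ℕ), d < c →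
          F (thresholdIndex c (d :: γ)) = F' (thresholdIndex (c - d) γ) := by
        refine ⟨fun j => if j = 0 then 0 else F (j + 1), rfl, fun c d γ hdc => ?_⟩
        rw [thresholdIndex_cons, if_neg (by omega)]
        by_cases h0 : thresholdIndex (c - d) γ = 0
        · simp [h0, hF]
        · simp [h0]
      simp only [hF' a b _ (by omega)]
      rw [ih (fun x hx => hβ x (List.mem_cons_of_mem _ hx)) (a - b) (by omega) (by omega) F' hF0,
        add_assoc]
      congr 1
      rcases Nat.eq_or_lt_of_le (show b + 1 ≤ a by omega) with rfl | hlt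
      · simp [thresholdIndex_cons]
      · rw [hF' a (b + 1) _ hlt, hF' (a - 1) b _ (by omega),
          show a - b - 1 = a - (b + 1) by omega, show a - 1 - b = a - (b + 1) by omega]
        have hc : ((a - 1 : ℕ) : ℚ) = ((a - (b + 1) : ℕ) : ℚ) + b := by
          norm_cast; omega
        rw [hc, add_mul]

theorem uriMult_zero (α : List ℕ) : uriMult 0 α = 0 := by
  simp [uriMult, thresholdMult]

theorem uriMult_eq {a : ℕ} (ha : 1 ≤ a) (α : List ℕ) :
    uriMult a α = (fun j => if j = 0 then 0 else B₁ α.length j) (thresholdIndex a α) := by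
  simp [uriMult, thresholdMult, show a ≠ 0 by omega]

theorem uriMult_nil (a : ℕ) : uriMult a [] = 0 := by
  simp [uriMult, thresholdMult, thresholdIndex_nil]

theorem sum_uriMult_raise (β : List ℕ) (hβ : ∀ x ∈ β, 0 < x) (a n : ℕ) (ha : 1 ≤ a)
    (h : β.sum + 1 = a + n) :
    ∑ i ∈ range β.length, (β.getD i 0 : ℚ) *
        uriMult a (β.take i ++ (β.getD i 0 + 1) :: β.drop (i + 1)) =
      n * uriMult a β + ((a - 1 : ℕ) : ℚ) * uriMult (a - 1) β := by
  have h1 := sum_thresholdIndex_raise β hβ a n ha h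
    (fun j => if j = 0 then 0 else B₁ β.length j) rfl
  have h2 : ∀ i ∈ range β.length,
      (β.take i ++ (β.getD i 0 + 1) :: β.drop (i + 1)).length = β.length := by
    intro i hi
    rw [mem_range] at hi
    simp only [List.length_append, List.length_take, List.length_cons, List.length_drop]
    omega
  rw [sum_congr rfl fun i hi => by rw [uriMult_eq ha, h2 i hi], h1, uriMult_eq ha]
  congr 1
  rcases Nat.eq_or_lt_of_le ha with rfl | ha'
  · simp
  · rw [uriMult_eq (by omega)]

/-! ### Left multiplications evaluated on letters -/

theorem exists_dp_eq_zero (x : LieV) : ∃ N, ∀ n, N ≤ n → dp n x = 0 := by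
  induction x using lieV_induction with
  | h0 => exact ⟨0, fun n _ => map_zero _⟩
  | hadd a b ha hb =>
    obtain ⟨M, hM⟩ := ha
    obtain ⟨N, hN⟩ := hb
    exact ⟨max M N, fun n hn => by
      rw [map_add, hM n (le_trans (le_max_left _ _) hn),
        hN n (le_trans (le_max_right _ _) hn), add_zero]⟩
  | hsmul c a ha =>
    obtain ⟨M, hM⟩ := ha
    exact ⟨M, fun n hn => by rw [map_smul, hM n hn, smul_zero]⟩
  | hbrk t =>
    refine ⟨∑ i, leaves t i + 1, fun n hn => ?_⟩
    rw [dp_brk]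
    refine sum_eq_zero fun l _ => if_neg ?_
    have : ∑ i, (leaves t i - l i) ≤ ∑ i, leaves t i := sum_le_sum fun i _ => Nat.sub_le _ _
    omega

theorem finite_support_dp (G : ℕ → Module.End ℚ LieV) (x : LieV) :
    (Function.support fun n => G n (dp n x)).Finite := by
  obtain ⟨N, hN⟩ := exists_dp_eq_zero x
  refine (Set.finite_lt_nat N).subset fun n hn => ?_
  by_contra hlt
  exact hn (by simp [hN n (by simpa using hlt)])

/-- The operator `x ↦ ∑ₙ Gₙ ((-δ)^n x / n!)`, a finite sum for each `x` since `δ` is locally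
nilpotent. -/
noncomputable def dpSum (G : ℕ → Module.End ℚ LieV) : LieV →ₗ[ℚ] LieV where
  toFun x := ∑ᶠ n, G n (dp n x)
  map_add' x y := by
    rw [← finsum_add_distrib (finite_support_dp G x) (finite_support_dp G y)]
    simp only [map_add]
  map_smul' c x := by
    rw [RingHom.id_apply, smul_finsum' c (finite_support_dp G x)]
    simp only [map_smul]

theorem dpSum_eq_sum (G : ℕ → Module.End ℚ LieV) {x : LieV} {N : ℕ}
    (hN : ∀ n, N ≤ n → dp n x = 0) : dpSum G x = ∑ n ∈ range N, G n (dp n x) := by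
  refine finsum_eq_sum_of_support_subset _ fun n hn => ?_
  rw [coe_range, Set.mem_Iio]
  by_contra hlt
  exact hn (by simp [hN n (by omega)])

/-- On a magma element `t(𝐤)`, the term of order `n` is the sum over the labels `𝐥` with
`|𝐤 - 𝐥| = n`. -/
theorem dpSum_brk (G : ℕ → Module.End ℚ LieV) (t : FreeMagma ℕ) :
    dpSum G (brk t) = ∑ l ∈ Iic (leaves t),
      ariMult (leaves t) l • G (∑ i, (leaves t i - l i)) (brk (relabel t l)) := by
  obtain ⟨N, hN⟩ := exists_dp_eq_zero (brk t)
  have hN' : ∀ n, max N (∑ i, leaves t i + 1) ≤ n → dp n (brk t) = 0 := fun n hn =>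
    hN n (le_trans (le_max_left _ _) hn)
  rw [dpSum_eq_sum G hN']
  simp only [dp_brk, map_sum]
  rw [sum_comm]
  refine sum_congr rfl fun l _ => ?_
  have hl : ∑ i, (leaves t i - l i) ≤ ∑ i, leaves t i := sum_le_sum fun i _ => Nat.sub_le _ _
  rw [sum_eq_single_of_mem (∑ i, (leaves t i - l i)), if_pos rfl, map_smul]
  · rw [mem_range]
    exact lt_of_lt_of_le (by omega) (le_max_right _ _)
  · intro n _ hn
    rw [if_neg hn.symm, map_zero]

/-- The part of `x ▷_a v_a` that applies to the `n`-th divided power of `x`. -/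
noncomputable def ariOp (a n : ℕ) : Module.End ℚ LieV := if a = 0 then 0 else adw [a + n]

/-- The part of `x ▷_u v_a` that applies to the `n`-th divided power of `x`. -/
noncomputable def uriOp (a n : ℕ) : Module.End ℚ LieV :=
  ∑ α : Composition (a + n), uriMult a α.blocks • adw α.blocks

theorem uriOp_zero (n : ℕ) : uriOp 0 n = 0 := by
  simp [uriOp, uriMult_zero]

theorem dpSum_uriOp_zero : dpSum (uriOp 0) = 0 := by
  ext x
  obtain ⟨N, hN⟩ := exists_dp_eq_zero x
  rw [dpSum_eq_sum _ hN]
  simp [uriOp_zero]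

theorem lieMap_ariLetter (t : FreeMagma ℕ) (a : ℕ) :
    lieMap (ariLetter t a) = dpSum (ariOp a) (brk t) := by
  rw [dpSum_brk, ariLetter]
  by_cases ha : a = 0
  · simp [ha, ariOp]
  · rw [if_neg ha, map_sum]
    refine sum_congr rfl fun l _ => ?_
    rw [map_smul, ariOp, if_neg ha, adw_cons, adw_nil, ← brk_mul]
    rfl

theorem lieMap_uriLetter (t : FreeMagma ℕ) (a : ℕ) :
    lieMap (uriLetter t a) = dpSum (uriOp a) (brk t) := by
  rw [dpSum_brk, uriLetter]
  by_cases ha : a = 0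
  · simp [ha, uriOp_zero]
  · rw [if_neg ha, map_sum]
    refine sum_congr rfl fun l _ => ?_
    rw [map_smul, map_sum, uriOp, LinearMap.sum_apply]
    congr 1
    refine sum_congr rfl fun α _ => ?_
    rw [map_smul, LinearMap.smul_apply, ← brk_nest]
    rfl

/-- The coefficient of `α` in `uriOp a n`. -/
noncomputable def uriCoeff (a n : ℕ) (α : List ℕ) : ℚ :=
  if α.sum = a + n then uriMult a α else 0

theorem uriCoeff_eq_zero {a n : ℕ} {α : List ℕ} (h : α.sum ≠ a + n) : uriCoeff a n α = 0 :=
  if_neg h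

theorem uriOp_apply {a n M : ℕ} (h : a + n ≤ M) (x : LieV) :
    uriOp a n x = ∑ α ∈ words M, uriCoeff a n α • adw α x := by
  rw [uriOp, LinearMap.sum_apply]
  simp only [LinearMap.smul_apply]
  rw [sum_composition (fun α => uriMult a α • adw α x) h]
  refine sum_congr rfl fun α _ => ?_
  rw [uriCoeff]
  split_ifs <;> simp

theorem sum_uriCoeff_raise (β : List ℕ) (hβ : ∀ x ∈ β, 0 < x) (a n : ℕ) (ha : 1 ≤ a) :
    ∑ i ∈ range β.length, (β.getD i 0 : ℚ) *
        uriCoeff a n (β.take i ++ (β.getD i 0 + 1) :: β.drop (i + 1)) =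
      n * uriCoeff a (n - 1) β + ((a - 1 : ℕ) : ℚ) * uriCoeff (a - 1) n β := by
  have hs : ∀ i ∈ range β.length,
      (β.take i ++ (β.getD i 0 + 1) :: β.drop (i + 1)).sum = β.sum + 1 := by
    intro i hi
    rw [mem_range] at hi
    have hd : β.drop i = β.getD i 0 :: β.drop (i + 1) := by
      rw [List.getD_eq_getElem _ _ hi]; exact List.drop_eq_getElem_cons hi
    have h2 : (β.take i).sum + (β.getD i 0 + (β.drop (i + 1)).sum) = β.sum := by
      rw [← List.sum_cons, ← hd, ← List.sum_append, List.take_append_drop]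
    rw [List.sum_append, List.sum_cons]
    omega
  by_cases h : β.sum + 1 = a + n
  · rw [sum_congr rfl fun i hi => by rw [uriCoeff, if_pos ((hs i hi).trans h)],
      sum_uriMult_raise β hβ a n ha h]
    congr 1
    · rcases Nat.eq_zero_or_pos n with rfl | hn
      · simp
      · rw [uriCoeff, if_pos (by omega)]
    · rw [uriCoeff, if_pos (by omega)]
  · rw [sum_eq_zero fun i hi => by rw [uriCoeff_eq_zero (by rw [hs i hi]; exact h), mul_zero],
      uriCoeff_eq_zero (show β.sum ≠ a - 1 + n by omega)]
    rcases Nat.eq_zero_or_pos n with rfl | hn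
    · simp
    · rw [uriCoeff_eq_zero (show β.sum ≠ a + (n - 1) by omega)]
      simp

theorem sum_Icc_shift {W : Type*} [AddCommMonoid W] (M : ℕ) (g : ℕ → W) (h1 : g 1 = 0)
    (h2 : g (M + 1) = 0) : ∑ b ∈ Icc 1 M, g b = ∑ b ∈ Icc 1 M, g (b + 1) := by
  have e : Icc 1 M = Ico 1 (M + 1) := by ext; simp
  rw [e, sum_Ico_eq_sum_range, sum_Ico_eq_sum_range]
  simp only [Nat.add_sub_cancel]
  have h3 := sum_range_succ (fun i => g (1 + i)) M
  rw [sum_range_succ', add_comm 1 M, h2, add_zero, add_zero, h1, add_zero] at h3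
  rw [← h3]
  rfl

/-- The commutator of the shift derivation with `uriOp a n`. -/
theorem shiftDer_uriOp (a n : ℕ) (ha : 1 ≤ a) (x : LieV) :
    shiftDer (uriOp a n x) = uriOp a n (shiftDer x) +
      ((n : ℚ) • uriOp a (n - 1) x + ((a - 1 : ℕ) : ℚ) • uriOp (a - 1) n x) := by
  rw [uriOp_apply (le_refl (a + n)), uriOp_apply (le_refl (a + n)),
    uriOp_apply (show a + (n - 1) ≤ a + n by omega),
    uriOp_apply (show a - 1 + n ≤ a + n by omega), map_sum]
  simp only [map_smul, lieDerivation_adw, smul_add, sum_add_distrib]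
  congr 1
  set M := a + n with hM
  -- Lowering a letter `b ≥ 1` of `α` to `b - 1` produces the word `β`; the sum is reindexed by `β`
  -- with the marked letter. The letter `1` drops out, since `δ v_1 = 0`.
  set f : List ℕ → ℕ → List ℕ → LieV := fun u b v =>
    (((b - 1 : ℕ) : ℚ) * uriCoeff a n (u ++ b :: v)) • adw (u ++ (b - 1) :: v) x with hf
  have hsum : ∀ (u v : List ℕ) (b : ℕ), (u ++ b :: v).sum = u.sum + (b + v.sum) := by
    intro u v b
    rw [List.sum_append, List.sum_cons]
  have e1 : ∑ α ∈ words M, uriCoeff a n α • ∑ i ∈ range α.length, adw (α.take i)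
        ⁅shiftDer (brk (of (α.getD i 0))), adw (α.drop (i + 1)) x⁆ =
      ∑ α ∈ words M, ∑ i ∈ range α.length, f (α.take i) (α.getD i 0) (α.drop (i + 1)) := by
    refine sum_congr rfl fun α _ => ?_
    rw [smul_sum]
    refine sum_congr rfl fun i hi => ?_
    rw [mem_range] at hi
    have hd : α.drop i = α.getD i 0 :: α.drop (i + 1) := by
      rw [List.getD_eq_getElem _ _ hi]; exact List.drop_eq_getElem_cons hi
    simp only [hf]
    rw [← hd, List.take_append_drop, shiftDer_of, smul_lie, map_smul, smul_smul, adw_append,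
      adw_cons, mul_comm]
  have e2 : ∀ u v, ∑ b ∈ Icc 1 M, f u b v = ∑ b ∈ Icc 1 M, f u (b + 1) v := by
    intro u v
    refine sum_Icc_shift M (fun b => f u b v) ?_ ?_
    · simp [hf]
    · simp only [hf]
      rw [uriCoeff_eq_zero (by rw [hsum]; omega), mul_zero, zero_smul]
  rw [e1, sum_words_split_letter M f]
  · rw [sum_congr rfl fun u _ => by rw [sum_comm, sum_congr rfl fun v _ => e2 u v, sum_comm],
      ← sum_words_split_letter M fun u b v => f u (b + 1) v]
    · rw [smul_sum, smul_sum, ← sum_add_distrib]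
      refine sum_congr rfl fun β hβ => ?_
      rw [smul_smul, smul_smul, ← add_smul,
        ← sum_uriCoeff_raise β (mem_words.1 hβ).1 a n ha, sum_smul]
      refine sum_congr rfl fun i hi => ?_
      rw [mem_range] at hi
      have hd : β.drop i = β.getD i 0 :: β.drop (i + 1) := by
        rw [List.getD_eq_getElem _ _ hi]; exact List.drop_eq_getElem_cons hi
      simp only [hf, Nat.add_sub_cancel]
      rw [← hd, List.take_append_drop]
    · intro u b v h
      simp only [hf]
      rw [uriCoeff_eq_zero (by rw [hsum]; omega), mul_zero, zero_smul]
  · intro u b v h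
    simp only [hf]
    rw [uriCoeff_eq_zero (by rw [hsum]; omega), mul_zero, zero_smul]

/-- On the letter `v_a`, left multiplication by `x` commutes with `δ`, as `δ v_a = (a - 1) v_{a-1}`.
For `a ≤ 1` both sides vanish. -/
theorem shiftDer_dpSum_uriOp (a : ℕ) (x : LieV) :
    shiftDer (dpSum (uriOp a) x) = ((a - 1 : ℕ) : ℚ) • dpSum (uriOp (a - 1)) x := by
  rcases Nat.eq_zero_or_pos a with rfl | ha
  · simp [dpSum_uriOp_zero]
  obtain ⟨N, hN⟩ := exists_dp_eq_zero x
  rw [dpSum_eq_sum _ hN, dpSum_eq_sum _ hN, map_sum]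
  simp only [shiftDer_uriOp a _ ha, sum_add_distrib, smul_sum]
  rw [← add_assoc, add_eq_right]
  -- As `δ (dp n x) = -(n + 1) dp (n + 1) x`, the first two sums cancel after a shift of `n`.
  have h := sum_range_succ (fun n => (n : ℚ) • uriOp a (n - 1) (dp n x)) N
  rw [sum_range_succ', hN N le_rfl, map_zero, smul_zero, Nat.cast_zero, zero_smul, add_zero,
    add_zero] at h
  rw [← h, ← sum_add_distrib]
  refine sum_eq_zero fun n _ => ?_
  rw [shiftDer_dp, map_smul, Nat.add_sub_cancel, neg_smul, neg_add_cancel]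

/-- The product `▷_u` on the free Lie algebra. -/
noncomputable def uriLie : LieV →ₗ[ℚ] LieV →ₗ[ℚ] LieV := lieExt fun a => dpSum (uriOp a)

/-- The product `▷_a` on the free Lie algebra. -/
noncomputable def ariLie : LieV →ₗ[ℚ] LieV →ₗ[ℚ] LieV := lieExt fun a => dpSum (ariOp a)

theorem descendsTo_uriLie : DescendsTo uriMag uriLie := descendsTo_lieExt _ _ lieMap_uriLetter

theorem descendsTo_ariLie : DescendsTo ariMag ariLie := descendsTo_lieExt _ _ lieMap_ariLetter

/-- Left multiplications for `▷_u` commute with the shift derivation. -/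
theorem uriLie_shiftDer (x y : LieV) : uriLie x (shiftDer y) = shiftDer (uriLie x y) := by
  have h : ⁅derExt (fun a => dpSum (uriOp a) x), shiftDer⁆ = 0 := by
    refine lieDerivation_ext fun a => ?_
    rw [LieDerivation.commutator_apply, shiftDer_of, map_smul, derExt_of, derExt_of,
      shiftDer_dpSum_uriOp, sub_self, LieDerivation.zero_apply]
  have h' := LieDerivation.congr_fun h y
  rw [LieDerivation.commutator_apply, LieDerivation.zero_apply, sub_eq_zero] at h'
  exact h'

theorem uriLie_dp (n : ℕ) (x y : LieV) : uriLie x (dp n y) = dp n (uriLie x y) := by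
  have h : ∀ n, uriLie x (shiftDer^[n] y) = shiftDer^[n] (uriLie x y) := by
    intro n
    induction n with
    | zero => rfl
    | succ n ih => rw [Function.iterate_succ_apply', Function.iterate_succ_apply',
        uriLie_shiftDer, ih]
  rw [dp_apply, dp_apply, map_smul, h]

/-! ### The post-Lie identity -/

/-- The part of `x ▷_u (y ▷_u v_a)` in which `x` acts on the letters produced by the action of `y`,
where `u` and `v` stand for the divided powers of orders `m` and `n` of `x` and `y`. The value is
the same for all `M ≥ a + n`. -/
noncomputable def uriGraft (M a m n : ℕ) (u v : LieV) : LieV :=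
  ∑ α ∈ words M, uriCoeff a n α • ∑ i ∈ range α.length,
    adw (α.take i) ⁅uriOp (α.getD i 0) m u, adw (α.drop (i + 1)) v⁆

/-- The contribution to the coefficient of `⁅adw σ u, adw θ v⁆` in `uriGraft M a m n u v` of a
decomposition `σ = (σ₁, σ₂)`, `θ = (θ₁, θ₂)`. -/
noncomputable def graftTerm (a m : ℕ) (σ₁ σ₂ θ₁ θ₂ : List ℕ) : ℚ :=
  uriMult (σ₂.sum - m) σ₂ * sumMult uriMult a (glue (shuffle σ₁ θ₁) (σ₂.sum - m) [θ₂])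

/-- The coefficient of `⁅adw σ u, adw θ v⁆` in `uriGraft M a m n u v`. -/
noncomputable def graftCoeff (a m n : ℕ) (σ θ : List ℕ) : ℚ :=
  if σ.sum + θ.sum = a + m + n then
    ∑ i ∈ range (σ.length + 1), ∑ j ∈ range (θ.length + 1),
      graftTerm a m (σ.take i) (σ.drop i) (θ.take j) (θ.drop j)
  else 0

theorem sumMult_glue_singleton (σ θ γ : List ℕ) (a b : ℕ) :
    sumMult uriMult a (glue (shuffle σ θ) b [γ]) =
      shuffleSum (fun w => uriMult a (w ++ b :: γ)) σ θ := by
  simp [sumMult, glue, shuffleSum, List.flatMap, Function.comp_def]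

theorem shuffleSum_mul_right (c : List ℕ → ℚ) (k : ℚ) (σ θ : List ℕ) :
    shuffleSum (fun w => c w * k) σ θ = shuffleSum c σ θ * k := by
  simp only [shuffleSum]
  rw [List.sum_map_mul_right]

theorem sum_append_cons (u v : List ℕ) (b : ℕ) : (u ++ b :: v).sum = u.sum + (b + v.sum) := by
  rw [List.sum_append, List.sum_cons]

/-- Only the letter `b = |ω| - m` can be produced by letting `ω` act on a divided power of
order `m`. -/
theorem sum_letter_eq_graftTerm (M a m n : ℕ) (σ₁ ω θ₁ γ : List ℕ) (hω : ω.sum ≤ M) :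
    ∑ b ∈ Icc 1 M, shuffleSum (fun w => uriCoeff a n (w ++ b :: γ) * uriCoeff b m ω) σ₁ θ₁ =
      if σ₁.sum + ω.sum + (θ₁.sum + γ.sum) = a + m + n then graftTerm a m σ₁ ω θ₁ γ else 0 := by
  have hb : ∀ b ∈ Icc 1 M, b ≠ ω.sum - m →
      shuffleSum (fun w => uriCoeff a n (w ++ b :: γ) * uriCoeff b m ω) σ₁ θ₁ = 0 := by
    intro b hb hne
    rw [mem_Icc] at hb
    rw [shuffleSum_mul_right, uriCoeff_eq_zero (show ω.sum ≠ b + m by omega), mul_zero]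
  -- If `|ω| ≤ m`, the truncated difference is `0` and both sides vanish, as `μ_{0,ω} = 0`.
  rcases Nat.eq_zero_or_pos (ω.sum - m) with h0 | hpos
  · rw [sum_eq_zero fun b hb' => hb b hb' ?_]
    · rw [graftTerm, h0, uriMult_zero, zero_mul, ite_self]
    · have := (mem_Icc.1 hb').1
      omega
  · rw [sum_eq_single_of_mem (ω.sum - m) (mem_Icc.2 ⟨hpos, by omega⟩) hb, shuffleSum_mul_right,
      show uriCoeff (ω.sum - m) m ω = uriMult (ω.sum - m) ω from if_pos (by omega)]
    by_cases h : σ₁.sum + ω.sum + (θ₁.sum + γ.sum) = a + m + n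
    · rw [if_pos h, graftTerm, sumMult_glue_singleton, mul_comm]
      congr 1
      refine shuffleSum_congr fun w hw => if_pos ?_
      rw [sum_append_cons]
      omega
    · rw [if_neg h, shuffleSum_eq_zero, zero_mul]
      intro w hw
      refine uriCoeff_eq_zero ?_
      rw [sum_append_cons]
      omega

theorem uriGraft_eq (M a m n : ℕ) (hM : a + m + n ≤ M) (u v : LieV) :
    uriGraft M a m n u v =
      ∑ σ ∈ words M, ∑ θ ∈ words M, graftCoeff a m n σ θ • ⁅adw σ u, adw θ v⁆ := by
  have e1 : uriGraft M a m n u v = ∑ β ∈ words M, ∑ b ∈ Icc 1 M, ∑ γ ∈ words M,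
      ∑ ω ∈ words M, (uriCoeff a n (β ++ b :: γ) * uriCoeff b m ω) •
        adw β ⁅adw ω u, adw γ v⁆ := by
    rw [← sum_words_split_letter M fun β b γ => ∑ ω ∈ words M,
      (uriCoeff a n (β ++ b :: γ) * uriCoeff b m ω) • adw β ⁅adw ω u, adw γ v⁆]
    · refine sum_congr rfl fun α hα => ?_
      rw [smul_sum]
      refine sum_congr rfl fun i hi => ?_
      rw [mem_range] at hi
      have hd : α.drop i = α.getD i 0 :: α.drop (i + 1) := by
        rw [List.getD_eq_getElem _ _ hi]; exact List.drop_eq_getElem_cons hi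
      rw [← hd, List.take_append_drop]
      by_cases h : α.sum = a + n
      · have h2 : (α.take i).sum + (α.getD i 0 + (α.drop (i + 1)).sum) = α.sum := by
          rw [← List.sum_cons, ← hd, ← List.sum_append, List.take_append_drop]
        rw [uriOp_apply (show α.getD i 0 + m ≤ M by omega), sum_lie, map_sum, smul_sum]
        refine sum_congr rfl fun ω _ => ?_
        rw [smul_lie, map_smul, smul_smul]
      · simp [uriCoeff_eq_zero h]
    · intro β b γ h
      refine sum_eq_zero fun ω _ => ?_
      rw [uriCoeff_eq_zero (by rw [sum_append_cons]; omega), zero_mul, zero_smul]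
  -- `β` is distributed over the bracket, and the sum over `b` collapses.
  have e2 : uriGraft M a m n u v = ∑ σ₁ ∈ words M, ∑ ω ∈ words M, ∑ θ₁ ∈ words M,
      ∑ γ ∈ words M,
        (if σ₁.sum + ω.sum + (θ₁.sum + γ.sum) = a + m + n then graftTerm a m σ₁ ω θ₁ γ else 0) •
          ⁅adw (σ₁ ++ ω) u, adw (θ₁ ++ γ) v⁆ := by
    calc uriGraft M a m n u v
        = ∑ ω ∈ words M, ∑ γ ∈ words M, ∑ b ∈ Icc 1 M, ∑ β ∈ words M,
            (uriCoeff a n (β ++ b :: γ) * uriCoeff b m ω) • adw β ⁅adw ω u, adw γ v⁆ := by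
          rw [e1, sum_comm, sum_congr rfl fun b _ => sum_comm, sum_comm,
            sum_congr rfl fun γ _ => (sum_congr rfl fun b _ => sum_comm).trans sum_comm,
            sum_comm]
      _ = ∑ ω ∈ words M, ∑ γ ∈ words M, ∑ b ∈ Icc 1 M, ∑ σ₁ ∈ words M, ∑ θ₁ ∈ words M,
            shuffleSum (fun w => uriCoeff a n (w ++ b :: γ) * uriCoeff b m ω) σ₁ θ₁ •
              ⁅adw (σ₁ ++ ω) u, adw (θ₁ ++ γ) v⁆ := by
          refine sum_congr rfl fun ω _ => sum_congr rfl fun γ _ => sum_congr rfl fun b _ => ?_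
          rw [sum_adw_lie M fun w => uriCoeff a n (w ++ b :: γ) * uriCoeff b m ω]
          · simp only [adw_append]
          · intro w hw
            rw [uriCoeff_eq_zero (by rw [sum_append_cons]; omega), zero_mul]
      _ = ∑ ω ∈ words M, ∑ γ ∈ words M, ∑ σ₁ ∈ words M, ∑ θ₁ ∈ words M,
            (if σ₁.sum + ω.sum + (θ₁.sum + γ.sum) = a + m + n then
              graftTerm a m σ₁ ω θ₁ γ else 0) • ⁅adw (σ₁ ++ ω) u, adw (θ₁ ++ γ) v⁆ := by
          refine sum_congr rfl fun ω hω => sum_congr rfl fun γ _ => ?_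
          rw [sum_comm]
          refine sum_congr rfl fun σ₁ _ => ?_
          rw [sum_comm]
          refine sum_congr rfl fun θ₁ _ => ?_
          rw [← sum_smul, sum_letter_eq_graftTerm M a m n σ₁ ω θ₁ γ (mem_words.1 hω).2]
      _ = _ := by
          rw [sum_comm,
            sum_congr rfl fun γ _ => sum_comm, sum_comm]
          refine sum_congr rfl fun σ₁ _ => ?_
          rw [sum_comm]
          refine sum_congr rfl fun ω _ => ?_
          rw [sum_comm]
  have hz : ∀ σ₁ ω θ₁ γ : List ℕ, σ₁.sum + ω.sum + (θ₁.sum + γ.sum) ≠ a + m + n →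
      (if σ₁.sum + ω.sum + (θ₁.sum + γ.sum) = a + m + n then
        graftTerm a m σ₁ ω θ₁ γ else 0) • ⁅adw (σ₁ ++ ω) u, adw (θ₁ ++ γ) v⁆ = 0 := by
    intro σ₁ ω θ₁ γ h
    rw [if_neg h, zero_smul]
  -- The pairs `(σ₁, ω)` and `(θ₁, γ)` are the decompositions of `σ` and of `θ`.
  rw [e2, ← sum_words_split M]
  · refine sum_congr rfl fun σ _ => ?_
    rw [sum_congr rfl fun i _ => (sum_words_split M (fun θ₁ γ => (if (σ.take i).sum +
      (σ.drop i).sum + (θ₁.sum + γ.sum) = a + m + n then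
        graftTerm a m (σ.take i) (σ.drop i) θ₁ γ else 0) •
          ⁅adw (σ.take i ++ σ.drop i) u, adw (θ₁ ++ γ) v⁆)
      fun θ₁ γ h => hz _ _ _ _ (by omega)).symm, sum_comm]
    refine sum_congr rfl fun θ _ => ?_
    have ht : ∀ (w : List ℕ) (i : ℕ), (w.take i).sum + (w.drop i).sum = w.sum := by
      intro w i
      rw [← List.sum_append, List.take_append_drop]
    simp only [ht, List.take_append_drop]
    rw [graftCoeff]
    split_ifs with h
    · simp only [sum_smul]
    · simp
  · intro σ₁ ω h
    exact sum_eq_zero fun θ₁ _ => sum_eq_zero fun γ _ => hz _ _ _ _ (by omega)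

/-- The threshold shuffle identity for two words, as an identity of coefficients. -/
theorem shuffleSum_uriCoeff (H : ThresholdShuffle uriMult) (a m n : ℕ) (σ θ : List ℕ)
    (hσ : ∀ x ∈ σ, 0 < x) (hθ : ∀ x ∈ θ, 0 < x) :
    shuffleSum (uriCoeff a (m + n)) σ θ = graftCoeff a m n σ θ + graftCoeff a n m θ σ := by
  by_cases h : σ.sum + θ.sum = a + m + n
  · have h2 := H.two σ θ hσ hθ m n a (by omega)
    rw [graftCoeff, graftCoeff, if_pos h, if_pos (by omega),
      sum_comm (s := range (θ.length + 1)), ← sum_add_distrib,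
      shuffleSum_congr (c := uriCoeff a (m + n)) (d := uriMult a) fun w hw => if_pos (by omega)]
    refine h2.trans (sum_congr rfl fun i _ => ?_)
    rw [← sum_add_distrib]
    refine sum_congr rfl fun j _ => ?_
    rw [graftTerm, graftTerm]
    simp only [sumMult_glue_singleton]
    rw [shuffleSum_comm _ (θ.take j)]
  · rw [graftCoeff, graftCoeff, if_neg h, if_neg (by omega), add_zero]
    exact shuffleSum_eq_zero fun w hw => uriCoeff_eq_zero (by omega)

/-- The post-Lie identity on a letter, for one pair of orders of divided powers. The sign comes from
`⁅adw θ v, adw σ u⁆ = -⁅adw σ u, adw θ v⁆`. -/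
theorem uriOp_lie (H : ThresholdShuffle uriMult) (M a m n : ℕ) (hM : a + m + n ≤ M)
    (u v : LieV) :
    uriOp a (m + n) ⁅u, v⁆ = uriGraft M a m n u v - uriGraft M a n m v u := by
  rw [uriOp_apply (show a + (m + n) ≤ M by omega),
    sum_adw_lie M _ fun w hw => uriCoeff_eq_zero (by omega), uriGraft_eq M a m n hM,
    uriGraft_eq M a n m (by omega), sum_comm (f := fun σ θ => graftCoeff a n m σ θ • _),
    ← sum_sub_distrib]
  refine sum_congr rfl fun σ hσ => ?_
  rw [← sum_sub_distrib]
  refine sum_congr rfl fun θ hθ => ?_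
  rw [shuffleSum_uriCoeff H a m n σ θ (mem_words.1 hσ).1 (mem_words.1 hθ).1, add_smul,
    ← lie_skew (adw θ v), smul_neg, sub_neg_eq_add]

theorem dpSum_lie (G : ℕ → Module.End ℚ LieV) {x y : LieV} {N : ℕ}
    (hx : ∀ n, N ≤ n → dp n x = 0) (hy : ∀ n, N ≤ n → dp n y = 0) :
    dpSum G ⁅x, y⁆ = ∑ m ∈ range N, ∑ n ∈ range N, G (m + n) ⁅dp m x, dp n y⁆ := by
  have hz : ∀ m n, N ≤ m ∨ N ≤ n → ⁅dp m x, dp n y⁆ = 0 := by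
    rintro m n (h | h)
    · rw [hx m h, zero_lie]
    · rw [hy n h, lie_zero]
  rw [dpSum_eq_sum G (N := N + N)]
  · rw [← sum_product', ← sum_fiberwise_of_maps_to (t := range (N + N))
      (g := fun p : ℕ × ℕ => p.1 + p.2)]
    · refine sum_congr rfl fun k _ => ?_
      rw [dp_lie, map_sum]
      symm
      refine sum_congr_of_eq_on_inter ?_ ?_ ?_
      · rintro ⟨m, n⟩ h h'
        simp only [mem_filter] at h
        exact absurd (HasAntidiagonal.mem_antidiagonal.2 h.2) h'
      · rintro ⟨m, n⟩ h h'
        rw [HasAntidiagonal.mem_antidiagonal] at h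
        simp only [mem_filter, mem_product, mem_range, h, and_true, not_and_or, not_lt] at h'
        simp only [hz m n h', map_zero]
      · rintro ⟨m, n⟩ h _
        simp only [mem_filter] at h
        rw [← h.2]
    · rintro ⟨m, n⟩ h
      simp only [mem_product, mem_range] at h ⊢
      omega
  · intro n hn
    rw [dp_lie]
    refine sum_eq_zero fun ij hij => hz _ _ ?_
    have := HasAntidiagonal.mem_antidiagonal.1 hij
    omega

theorem uriLie_brk_of (x : LieV) (a : ℕ) : uriLie x (brk (of a)) = dpSum (uriOp a) x :=
  derExt_of _ _

theorem uriLie_lie (x y z : LieV) : uriLie x ⁅y, z⁆ = ⁅uriLie x y, z⁆ + ⁅y, uriLie x z⁆ := by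
  rw [add_comm]
  exact LieDerivation.apply_lie_eq_add _ y z

/-- The Leibniz rule for `x ▷_u (y ▷_u v_a)`: either `x` acts on the divided powers of `y`, which
gives `(x ▷_u y) ▷_u v_a` by `uriLie_dp`, or it acts on a letter. -/
theorem uriLie_dpSum {x y : LieV} {N M a : ℕ} (hM : a + N ≤ M)
    (hx : ∀ n, N ≤ n → dp n x = 0) (hy : ∀ n, N ≤ n → dp n y = 0) :
    uriLie x (dpSum (uriOp a) y) = dpSum (uriOp a) (uriLie x y) +
      ∑ m ∈ range N, ∑ n ∈ range N, uriGraft M a m n (dp m x) (dp n y) := by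
  have hxy : ∀ n, N ≤ n → dp n (uriLie x y) = 0 := fun n hn => by
    rw [← uriLie_dp, hy n hn, map_zero]
  rw [dpSum_eq_sum _ hy, dpSum_eq_sum _ hxy, map_sum, sum_comm, ← sum_add_distrib]
  refine sum_congr rfl fun n hn => ?_
  rw [mem_range] at hn
  rw [uriOp_apply (show a + n ≤ M by omega), uriOp_apply (show a + n ≤ M by omega), map_sum]
  simp only [uriGraft]
  rw [sum_comm, ← sum_add_distrib]
  refine sum_congr rfl fun α _ => ?_
  have h := lieDerivation_adw (derExt fun a => dpSum (uriOp a) x) α (dp n y)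
  change uriLie x _ = adw α (uriLie x _) + _ at h
  rw [map_smul, h, smul_add, uriLie_dp, ← smul_sum, sum_comm]
  congr 2
  refine sum_congr rfl fun i _ => ?_
  rw [derExt_of, dpSum_eq_sum _ hx, sum_lie, map_sum]

/-- The action of a bracket on a letter: the terms in which `x` acts on the divided powers of `y`
cancel because left multiplications commute with the shift derivation, and the remaining ones are
compared by the threshold shuffle identities. -/
theorem dpSum_uriOp_lie (H : ThresholdShuffle uriMult) (a : ℕ) (x y : LieV) :
    dpSum (uriOp a) ⁅x, y⁆ = uriLie x (dpSum (uriOp a) y) - dpSum (uriOp a) (uriLie x y) -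
      uriLie y (dpSum (uriOp a) x) + dpSum (uriOp a) (uriLie y x) := by
  obtain ⟨N₁, h₁⟩ := exists_dp_eq_zero x
  obtain ⟨N₂, h₂⟩ := exists_dp_eq_zero y
  set N := max N₁ N₂ with hN
  have hx : ∀ n, N ≤ n → dp n x = 0 := fun n hn => h₁ n (by omega)
  have hy : ∀ n, N ≤ n → dp n y = 0 := fun n hn => h₂ n (by omega)
  have hM : a + N ≤ a + N + N := by omega
  rw [dpSum_lie _ hx hy, uriLie_dpSum hM hx hy, uriLie_dpSum hM hy hx]
  have e : ∑ m ∈ range N, ∑ n ∈ range N, uriOp a (m + n) ⁅dp m x, dp n y⁆ =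
      ∑ m ∈ range N, ∑ n ∈ range N, uriGraft (a + N + N) a m n (dp m x) (dp n y) -
        ∑ m ∈ range N, ∑ n ∈ range N, uriGraft (a + N + N) a m n (dp m y) (dp n x) := by
    rw [sum_comm (f := fun m n => uriGraft (a + N + N) a m n (dp m y) (dp n x)),
      ← sum_sub_distrib]
    refine sum_congr rfl fun m hm => ?_
    rw [← sum_sub_distrib]
    refine sum_congr rfl fun n hn => ?_
    rw [mem_range] at hm hn
    exact uriOp_lie H _ a m n (by omega) _ _
  rw [e]
  abel

theorem isPostLie_uriLie (H : ThresholdShuffle uriMult) : IsPostLie uriLie where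
  derivation := uriLie_lie
  bracket x y z := by
    let D : LieV → LieDerivation ℚ LieV LieV := fun x => derExt fun a => dpSum (uriOp a) x
    have h : D ⁅x, y⁆ = ⁅D x, D y⁆ - D (uriLie x y) + D (uriLie y x) := by
      refine lieDerivation_ext fun a => ?_
      rw [LieDerivation.add_apply, LieDerivation.sub_apply, LieDerivation.commutator_apply]
      change uriLie ⁅x, y⁆ (brk (of a)) = uriLie x (uriLie y (brk (of a))) -
        uriLie y (uriLie x (brk (of a))) - uriLie (uriLie x y) (brk (of a)) +
          uriLie (uriLie y x) (brk (of a))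
      simp only [uriLie_brk_of]
      rw [dpSum_uriOp_lie H]
      abel
    have h' := LieDerivation.congr_fun h z
    rw [LieDerivation.add_apply, LieDerivation.sub_apply, LieDerivation.commutator_apply] at h'
    change uriLie ⁅x, y⁆ z = uriLie x (uriLie y z) - uriLie y (uriLie x z) -
      uriLie (uriLie x y) z + uriLie (uriLie y x) z at h'
    rw [h']
    abel

/-! ### The depth filtration -/

theorem brk_mem_depthPart (t : FreeMagma ℕ) : brk t ∈ depthPart t.length :=
  Submodule.subset_span ⟨t, rfl, rfl⟩

theorem depthPart_le_depthFil {p e : ℕ} (h : p ≤ e) : depthPart e ≤ depthFil p :=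
  le_iSup₂_of_le e h le_rfl

theorem depthFil_le {p : ℕ} {S : Submodule ℚ LieV} (h : ∀ e, p ≤ e → depthPart e ≤ S) :
    depthFil p ≤ S :=
  iSup₂_le h

theorem depthFil_anti {p q : ℕ} (h : p ≤ q) : depthFil q ≤ depthFil p :=
  depthFil_le fun _ he => depthPart_le_depthFil (h.trans he)

theorem depthPart_le {d : ℕ} {S : Submodule ℚ LieV}
    (h : ∀ t : FreeMagma ℕ, t.length = d → brk t ∈ S) : depthPart d ≤ S := by
  refine Submodule.span_le.2 ?_
  rintro _ ⟨t, ht, rfl⟩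
  exact h t ht

theorem lie_mem_depthPart {p q : ℕ} {x y : LieV} (hx : x ∈ depthPart p) (hy : y ∈ depthPart q) :
    ⁅x, y⁆ ∈ depthPart (p + q) := by
  have h : depthPart p ≤ (depthPart (p + q)).comap
      ((LieAlgebra.ad ℚ LieV : LieV →ₗ[ℚ] Module.End ℚ LieV).flip y) := by
    refine depthPart_le fun s hs => ?_
    have h' : depthPart q ≤ (depthPart (p + q)).comap (LieAlgebra.ad ℚ LieV (brk s)) := by
      refine depthPart_le fun t ht => ?_
      change ⁅brk s, brk t⁆ ∈ depthPart (p + q)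
      rw [← brk_mul, ← hs, ← ht]
      exact brk_mem_depthPart (s * t)
    exact h' hy
  exact h hx

theorem lie_mem_depthFil {p q : ℕ} {x y : LieV} (hx : x ∈ depthFil p) (hy : y ∈ depthFil q) :
    ⁅x, y⁆ ∈ depthFil (p + q) := by
  have h : depthFil p ≤ (depthFil (p + q)).comap
      ((LieAlgebra.ad ℚ LieV : LieV →ₗ[ℚ] Module.End ℚ LieV).flip y) := by
    refine depthFil_le fun e he u hu => ?_
    have h' : depthFil q ≤ (depthFil (p + q)).comap (LieAlgebra.ad ℚ LieV u) := by
      refine depthFil_le fun f hf v hv => ?_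
      exact depthPart_le_depthFil (add_le_add he hf) (lie_mem_depthPart hu hv)
    exact h' hy
  exact h hx

/-- A derivation which raises the depth of letters by `r` raises the depth of everything by `r`. -/
theorem derExt_mem_depthPart {F : ℕ → LieV} {r q : ℕ} (hF : ∀ a, F a ∈ depthPart (r + 1))
    {y : LieV} (hy : y ∈ depthPart q) : derExt F y ∈ depthPart (r + q) := by
  have h : ∀ t : FreeMagma ℕ, derExt F (brk t) ∈ depthPart (r + t.length) := by
    intro t
    induction t with
    | ih1 a => rw [derExt_of]; exact hF a
    | ih2 s t hs ht =>
      rw [brk_mul, LieDerivation.apply_lie_eq_add]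
      change _ ∈ depthPart (r + (s.length + t.length))
      refine add_mem ?_ ?_
      · rw [show r + (s.length + t.length) = s.length + (r + t.length) by omega]
        exact lie_mem_depthPart (brk_mem_depthPart s) ht
      · rw [← add_assoc]
        exact lie_mem_depthPart hs (brk_mem_depthPart t)
  have h' : depthPart q ≤ (depthPart (r + q)).comap (derExt F : LieV →ₗ[ℚ] LieV) :=
    depthPart_le fun t ht => by rw [← ht]; exact h t
  exact h' hy

theorem derExt_mem_depthFil {F : ℕ → LieV} {r q : ℕ} (hF : ∀ a, F a ∈ depthFil (r + 1))
    {y : LieV} (hy : y ∈ depthFil q) : derExt F y ∈ depthFil (r + q) := by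
  have h : ∀ t : FreeMagma ℕ, derExt F (brk t) ∈ depthFil (r + t.length) := by
    intro t
    induction t with
    | ih1 a => rw [derExt_of]; exact hF a
    | ih2 s t hs ht =>
      rw [brk_mul, LieDerivation.apply_lie_eq_add]
      change _ ∈ depthFil (r + (s.length + t.length))
      refine add_mem ?_ ?_
      · rw [show r + (s.length + t.length) = s.length + (r + t.length) by omega]
        exact lie_mem_depthFil (depthPart_le_depthFil le_rfl (brk_mem_depthPart s)) ht
      · rw [← add_assoc]
        exact lie_mem_depthFil hs (depthPart_le_depthFil le_rfl (brk_mem_depthPart t))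
  have h' : depthFil q ≤ (depthFil (r + q)).comap (derExt F : LieV →ₗ[ℚ] LieV) :=
    depthFil_le fun e he => depthPart_le fun t ht =>
      depthFil_anti (by omega) (h t)
  exact h' hy

theorem shiftDer_mem_depthPart {d : ℕ} {x : LieV} (hx : x ∈ depthPart d) :
    shiftDer x ∈ depthPart d := by
  have := derExt_mem_depthPart (r := 0)
    (F := fun k => ((k - 1 : ℕ) : ℚ) • brk (of (k - 1)))
    (fun a => Submodule.smul_mem _ _ (brk_mem_depthPart (of (a - 1)))) hx
  rwa [zero_add] at this

theorem dp_mem_depthPart {d : ℕ} (n : ℕ) {x : LieV} (hx : x ∈ depthPart d) :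
    dp n x ∈ depthPart d := by
  rw [dp_apply]
  refine Submodule.smul_mem _ _ ?_
  induction n with
  | zero => exact hx
  | succ n ih =>
    rw [Function.iterate_succ_apply']
    exact shiftDer_mem_depthPart ih

theorem dp_mem_depthFil {d : ℕ} (n : ℕ) {x : LieV} (hx : x ∈ depthFil d) :
    dp n x ∈ depthFil d := by
  have h : depthFil d ≤ (depthFil d).comap (dp n) :=
    depthFil_le fun e he _ hu => depthPart_le_depthFil he (dp_mem_depthPart n hu)
  exact h hx

theorem dpSum_mem {G : ℕ → Module.End ℚ LieV} {S : Submodule ℚ LieV} {x : LieV}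
    (h : ∀ n, G n (dp n x) ∈ S) : dpSum G x ∈ S := by
  obtain ⟨N, hN⟩ := exists_dp_eq_zero x
  rw [dpSum_eq_sum G hN]
  exact sum_mem fun n _ => h n

theorem dpSum_sub (G G' : ℕ → Module.End ℚ LieV) (x : LieV) :
    dpSum G x - dpSum G' x = dpSum (G - G') x := by
  obtain ⟨N, hN⟩ := exists_dp_eq_zero x
  rw [dpSum_eq_sum G hN, dpSum_eq_sum G' hN, dpSum_eq_sum _ hN, ← sum_sub_distrib]
  rfl

theorem adw_mem_depthFil {p : ℕ} (α : List ℕ) {x : LieV} (hx : x ∈ depthFil p) :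
    adw α x ∈ depthFil (p + α.length) := by
  induction α with
  | nil => exact hx
  | cons b α ih =>
    rw [adw_cons, List.length_cons, show p + (α.length + 1) = 1 + (p + α.length) by omega]
    exact lie_mem_depthFil (depthPart_le_depthFil le_rfl (brk_mem_depthPart (of b))) ih

theorem ariOp_mem_depthPart {p : ℕ} (a n : ℕ) {x : LieV} (hx : x ∈ depthPart p) :
    ariOp a n x ∈ depthPart (p + 1) := by
  rw [ariOp]
  split_ifs with h
  · exact zero_mem _
  · rw [adw_cons, adw_nil, add_comm]
    exact lie_mem_depthPart (brk_mem_depthPart (of (a + n))) hx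

theorem uriOp_mem_depthFil {p : ℕ} (a n : ℕ) {x : LieV} (hx : x ∈ depthFil p) :
    uriOp a n x ∈ depthFil (p + 1) := by
  rw [uriOp_apply le_rfl]
  refine sum_mem fun α _ => ?_
  cases α with
  | nil =>
    rw [uriCoeff, uriMult_nil, ite_self, zero_smul]
    exact zero_mem _
  | cons b α =>
    refine Submodule.smul_mem _ _ (depthFil_anti ?_ (adw_mem_depthFil (b :: α) hx))
    simp only [List.length_cons]
    omega

theorem uriMult_singleton {a b : ℕ} (ha : 1 ≤ a) (h : a ≤ b) : uriMult a [b] = 1 := by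
  rw [uriMult_eq ha, thresholdIndex_cons, if_pos h]
  simp [B₁]

/-- Words of length one contribute the same terms to both products. -/
theorem uriOp_sub_ariOp_mem_depthFil {p : ℕ} (a n : ℕ) {x : LieV} (hx : x ∈ depthFil p) :
    uriOp a n x - ariOp a n x ∈ depthFil (p + 2) := by
  rcases Nat.eq_zero_or_pos a with rfl | ha
  · rw [uriOp_zero, ariOp, if_pos rfl]
    simp
  have h1 : [a + n] ∈ words (a + n) := mem_words.2 ⟨by simp; omega, by simp⟩
  have h2 : uriCoeff a n [a + n] = 1 := by
    rw [uriCoeff, if_pos (by simp), uriMult_singleton ha (by omega)]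
  rw [uriOp_apply le_rfl, ariOp, if_neg (by omega), ← add_sum_erase _ _ h1, h2, one_smul,
    add_sub_cancel_left]
  refine sum_mem fun α hα => ?_
  rw [mem_erase] at hα
  by_cases h : α.sum = a + n
  · refine Submodule.smul_mem _ _ (depthFil_anti ?_ (adw_mem_depthFil α hx))
    rcases α with _ | ⟨b, _ | ⟨c, α⟩⟩
    · simp only [List.sum_nil] at h
      omega
    · simp only [List.sum_cons, List.sum_nil, add_zero] at h
      exact absurd (by rw [h]) hα.1
    · simp only [List.length_cons]
      omega
  · rw [uriCoeff_eq_zero h, zero_smul]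
    exact zero_mem _

theorem isDepthGradedOf_ariLie_uriLie : IsDepthGradedOf ariLie uriLie where
  filtered p q x hx y hy := derExt_mem_depthFil
    (fun a => dpSum_mem fun n => uriOp_mem_depthFil a n (dp_mem_depthFil n hx)) hy
  graded p q x hx y hy := derExt_mem_depthPart
    (fun a => dpSum_mem fun n => ariOp_mem_depthPart a n (dp_mem_depthPart n hx)) hy
  agree p q x hx y hy := by
    have e : uriLie x y - ariLie x y =
        derExt (fun a => dpSum (uriOp a - ariOp a) x) y := by
      simp only [← dpSum_sub]
      exact (LieDerivation.congr_fun (derExt_sub _ _) y).symm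
    rw [e, show p + q + 1 = p + 1 + q by omega]
    exact derExt_mem_depthFil
      (fun a => dpSum_mem fun n => uriOp_sub_ariOp_mem_depthFil a n (dp_mem_depthFil n hx)) hy

end UriPostLie

theorem theorem6p8 :
    (∃! triU : UriPostLie.LieV →ₗ[ℚ] UriPostLie.LieV →ₗ[ℚ] UriPostLie.LieV,
      UriPostLie.DescendsTo UriPostLie.uriMag triU) ∧
    (∃! triA : UriPostLie.LieV →ₗ[ℚ] UriPostLie.LieV →ₗ[ℚ] UriPostLie.LieV,
      UriPostLie.DescendsTo UriPostLie.ariMag triA) ∧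
    ∀ triU triA : UriPostLie.LieV →ₗ[ℚ] UriPostLie.LieV →ₗ[ℚ] UriPostLie.LieV,
      UriPostLie.DescendsTo UriPostLie.uriMag triU →
      UriPostLie.DescendsTo UriPostLie.ariMag triA →
      (UriPostLie.ThresholdShuffle UriPostLie.uriMult → UriPostLie.IsPostLie triU) ∧
      UriPostLie.IsDepthGradedOf triA triU := by
  refine ⟨⟨UriPostLie.uriLie, UriPostLie.descendsTo_uriLie, fun T hT =>
      hT.unique UriPostLie.descendsTo_uriLie⟩,
    ⟨UriPostLie.ariLie, UriPostLie.descendsTo_ariLie, fun T hT =>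
      hT.unique UriPostLie.descendsTo_ariLie⟩, ?_⟩
  intro triU triA hU hA
  obtain rfl := hU.unique UriPostLie.descendsTo_uriLie
  obtain rfl := hA.unique UriPostLie.descendsTo_ariLie
  exact ⟨UriPostLie.isPostLie_uriLie, UriPostLie.isDepthGradedOf_ariLie_uriLie⟩
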